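/- **Setting.** Let $N\ge 1$, let $\alpha_1,\dots,\alpha_N\in\mathbb C$ be mutually distinct with imaginary parts all positive or all negative, and let $c_1,\dots,c_N\in\mathbb C$ be arbitrary. Write $'=\partial_s$ and $\dot{}=\partial_t$ for $s,t\in\mathbb R$. For $\lambda\in\mathbb C^\times$ put $$e(s,t,\lambda)=\exp\!\Big(\tfrac i2(\lambda s+\lambda^{-1}t)\Big),$$ $A=(\alpha_j^{\,k-1})_{j,k=1}^N$, $E=\operatorname{diag}(e(s,t,\alpha_j))$, $C=\operatorname{diag}(c_j)$, and $$T_0=\begin{pmatrix}EA&-CE^{-1}A\\ \overline{CE^{-1}A}&\overline{EA}\end{pmatrix},\qquad b=-\big(\alpha_1^Ne(s,t,\alpha_1),\dots,\alpha_N^Ne(s,t,\alpha_N),\ \overline{\alpha_1}^N\overline{c_1}\,e(s,t,\overline{\alpha_1}),\dots,\overline{\alpha_N}^N\overline{c_N}\,e(s,t,\overline{\alpha_N})\big)^{\mathsf T}.$$ For $1\le k\le 2N$ let $T_k$ be $T_0$ with its $k$-th column replaced by $b$, and let $d_k=d_k(s,t)=\det T_k$ for $0\le k\le 2N$. Date's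 wave function is the matrix $\Psi=(\Psi_{ij}(s,t,\lambda))_{i,j=1,2}$ with $$\Psi_{11}=\Big(\lambda^N+\sum_{j=0}^{N-1}\tfrac{d_{j+1}}{d_0}\lambda^j\Big)e(s,t,\lambda),\quad \Psi_{21}=-\Big(\sum_{j=0}^{N-1}\tfrac{d_{N+j+1}}{d_0}\lambda^j\Big)e(s,t,\lambda)^{-1},$$ $$\Psi_{12}(s,t,\lambda)=-\overline{\Psi_{21}(s,t,\bar\lambda)},\quad \Psi_{22}(s,t,\lambda)=\overline{\Psi_{11}(s,t,\bar\lambda)}.$$ Put $f(s,t,\lambda)=\Psi_{11}(s,t,\lambda)\,e(s,t,-\lambda)$, $g(s,t,\lambda)=\Psi_{21}(s,t,\lambda)\,e(s,t,\lambda)$, $q=2i\,\overline{d_{2N}/d_0}$, and, for $\lambda>0$, $F=\Psi/\sqrt{\det\Psi}$. Identify $\mathbb R^3$ with $\mathfrak{su}(2)$ by $$(p_1,p_2,p_3)^{\mathsf T}\longleftrightarrow\frac12\begin{pmatrix} ip_3&-p_1-ip_2\\ p_1-ip_2&-ip_3\end{pmatrix}.$$ The $N$-soliton curve $\gamma=(\gamma_1,\gamma_2,\gamma_3)^{\mathsf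 T}$ is the map $\gamma(s,t)=\lambda(\partial_\lambda F)F^{-1}\big|_{\lambda=1}$ read in $\mathbb R^3$. **Statement.** The following hold for all $s,t\in\mathbb R$. 1. $d_0\neq0$; $(1,c_j)\Psi(s,t,\alpha_j)=0$ for all $j$; and for every $\lambda\in\mathbb C^\times$ $$\Psi'=\Psi\cdot\frac12\begin{pmatrix}i\lambda&2i\,\overline{d_{2N}/d_0}\\ 2i\,d_{2N}/d_0&-i\lambda\end{pmatrix},\qquad \dot\Psi=\Psi\cdot\frac{i}{2\lambda(|d_1|^2+|d_{N+1}|^2)}\begin{pmatrix}|d_1|^2-|d_{N+1}|^2&2\overline{d_1d_{N+1}}\\2d_1d_{N+1}&-|d_1|^2+|d_{N+1}|^2\end{pmatrix}.$$ 2. For $\lambda\in\mathbb C^\times$, $f=\lambda^N+\sum_{j=0}^{N-1}\frac{d_{j+1}}{d_0}\lambda^j$ and $g=-\sum_{j=0}^{N-1}\frac{d_{N+j+1}}{d_0}\lambda^j$. 3. For $\lambda>0$, $\det\Psi=|f|^2+|g|^2>0$, and $F$ is a smooth function of $(s,t,\lambda)$ with values in $\mathrm{SU}(2)$. The function $q$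 is a smooth solution of the Pohlmeyer–Lund–Regge equation $\dot q'+\frac12 q\,h=0$ for some real function $h$ with $h'=(|q|^2)^{\boldsymbol\cdot}$, and, with the same $h$, for all $\lambda>0$ $$F'=F\cdot\frac12\begin{pmatrix}i\lambda&q\\-\bar q&-i\lambda\end{pmatrix},\qquad \dot F=F\cdot\frac{i}{2\lambda}\begin{pmatrix}h/2&-\dot q\\-\dot{\bar q}&-h/2\end{pmatrix}.$$ 4. $\lambda(\partial_\lambda F)F^{-1}|_{\lambda=1}\in\mathfrak{su}(2)$, and $\gamma$ is a smooth Lund–Regge evolution of unit speed: $\dot\gamma'=\gamma'\times\dot\gamma$ and $|\gamma'|=1$. 5. Explicitly (with $\lambda$ real in $\partial_\lambda$), $$\gamma_1=2\,\Re\!\left[\frac{\bar f\,\partial_\lambda g-g\,\partial_\lambda\bar f}{f\bar f+g\bar g}\,\bar e^{\,2}\right]_{\lambda=1},\qquad \gamma_2=-2\,\Im\!\left[\frac{\bar f\,\partial_\lambda g-g\,\partial_\lambda\bar f}{f\bar f+g\bar g}\,\bar e^{\,2}\right]_{\lambda=1},$$ $$\gamma_3=s-t+2\,\Im\!\left[\frac{\bar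 f\,\partial_\lambda f+g\,\partial_\lambda\bar g}{f\bar f+g\bar g}\right]_{\lambda=1}.$$ -/

import Mathlib

open scoped ContDiff ComplexConjugate

noncomputable section

namespace LundRegge

/-- The exponential `e(s,t,λ) = exp((i/2)(λ s + λ⁻¹ t))`. -/
def expFun (s t : ℝ) (l : ℂ) : ℂ :=
  Complex.exp (Complex.I / 2 * (l * (s : ℂ) + l⁻¹ * (t : ℂ)))

section Date

variable {N : ℕ} (α c : Fin N → ℂ)

/-- The block `E A`, with `A` the Vandermonde matrix `(α_j ^ k)` and `E = diag(e(α_j))`. -/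
def blockEA (s t : ℝ) : Matrix (Fin N) (Fin N) ℂ :=
  Matrix.diagonal (fun j => expFun s t (α j)) * Matrix.vandermonde α

/-- The block `C E⁻¹ A`, with `C = diag(c_j)`. -/
def blockCEA (s t : ℝ) : Matrix (Fin N) (Fin N) ℂ :=
  Matrix.diagonal c * Matrix.diagonal (fun j => (expFun s t (α j))⁻¹) * Matrix.vandermonde α

/-- The `2N × 2N` coefficient matrix `T₀`. -/
def coeffMatrix (s t : ℝ) : Matrix (Fin N ⊕ Fin N) (Fin N ⊕ Fin N) ℂ :=
  Matrix.fromBlocks (blockEA α s t) (-blockCEA α c s t)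
    ((blockCEA α c s t).map conj) ((blockEA α s t).map conj)

/-- The right-hand side `b` of the linear system `T₀ ψ = b`. -/
def rhsVec (s t : ℝ) : Fin N ⊕ Fin N → ℂ :=
  Sum.elim (fun j => -((α j) ^ N * expFun s t (α j)))
    (fun j => -((conj (α j)) ^ N * conj (c j) * expFun s t (conj (α j))))

/-- The position in `{1, …, 2N}` of a column of `T₀`. -/
def colNumber : Fin N ⊕ Fin N → ℕ :=
  Sum.elim (fun j => (j : ℕ) + 1) (fun j => N + (j : ℕ) + 1)

/-- `T_k`: the matrix `T₀` with its `k`-th column replaced by `b` when `1 ≤ k ≤ 2N`;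
for `k = 0` it is `T₀` itself, as no column has number `0`. -/
def cramerMatrix (k : ℕ) (s t : ℝ) : Matrix (Fin N ⊕ Fin N) (Fin N ⊕ Fin N) ℂ :=
  Matrix.of fun i j => if colNumber j = k then rhsVec α c s t i else coeffMatrix α c s t i j

/-- `d_k = det T_k`. -/
def d (k : ℕ) (s t : ℝ) : ℂ := (cramerMatrix α c k s t).det

/-- The entry `Ψ₁₁` of the wave function. -/
def Psi11 (s t : ℝ) (l : ℂ) : ℂ :=
  (l ^ N + ∑ j : Fin N, d α c ((j : ℕ) + 1) s t / d α c 0 s t * l ^ (j : ℕ)) *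
    Complex.exp (Complex.I / 2 * (l * (s : ℂ) + l⁻¹ * (t : ℂ)))

/-- The entry `Ψ₂₁` of the wave function. -/
def Psi21 (s t : ℝ) (l : ℂ) : ℂ :=
  -(∑ j : Fin N, d α c (N + (j : ℕ) + 1) s t / d α c 0 s t * l ^ (j : ℕ)) *
    Complex.exp (-(Complex.I / 2 * (l * (s : ℂ) + l⁻¹ * (t : ℂ))))

/-- Date's `N`-soliton wave function; `Ψ₁₂(λ) = -conj Ψ₂₁(conj λ)`,
`Ψ₂₂(λ) = conj Ψ₁₁(conj λ)`. -/
def Psi (s t : ℝ) (l : ℂ) : Matrix (Fin 2) (Fin 2) ℂ :=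
  !![Psi11 α c s t l, -conj (Psi21 α c s t (conj l));
     Psi21 α c s t l, conj (Psi11 α c s t (conj l))]

/-- `f(s,t,λ) = Ψ₁₁(s,t,λ) e(s,t,-λ)`. -/
def f (s t : ℝ) (l : ℂ) : ℂ := Psi α c s t l 0 0 * expFun s t (-l)

/-- `g(s,t,λ) = Ψ₂₁(s,t,λ) e(s,t,λ)`. -/
def g (s t : ℝ) (l : ℂ) : ℂ := Psi α c s t l 1 0 * expFun s t l

/-- The coefficient `Ψ⁻¹ Ψ'` of Date's Lax pair, in terms of the determinants. -/
def dateL (s t : ℝ) (l : ℂ) : Matrix (Fin 2) (Fin 2) ℂ :=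
  (1 / 2 : ℂ) • !![Complex.I * l, 2 * Complex.I * conj (d α c (2 * N) s t / d α c 0 s t);
    2 * Complex.I * (d α c (2 * N) s t / d α c 0 s t), -(Complex.I * l)]

/-- The coefficient of `Ψ⁻¹` times the `t`-derivative of `Ψ` in Date's Lax pair. -/
def dateM (s t : ℝ) (l : ℂ) : Matrix (Fin 2) (Fin 2) ℂ :=
  (Complex.I / (2 * l * ((‖d α c 1 s t‖ ^ 2 + ‖d α c (N + 1) s t‖ ^ 2 : ℝ) : ℂ))) •
    !![((‖d α c 1 s t‖ ^ 2 - ‖d α c (N + 1) s t‖ ^ 2 : ℝ) : ℂ),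
        2 * conj (d α c 1 s t * d α c (N + 1) s t);
      2 * (d α c 1 s t * d α c (N + 1) s t),
        ((-‖d α c 1 s t‖ ^ 2 + ‖d α c (N + 1) s t‖ ^ 2 : ℝ) : ℂ)]

/-- The `N`-soliton solution `q` of the Pohlmeyer-Lund-Regge equation. -/
def solitonSolution (s t : ℝ) : ℂ :=
  2 * Complex.I * conj (d α c (2 * N) s t / d α c 0 s t)

/-- The normalized wave function `F = Ψ / √(det Ψ)` for a real spectral parameter
(where `det Ψ` is a positive real number). -/
def frame (s t l : ℝ) : Matrix (Fin 2) (Fin 2) ℂ :=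
  ((Real.sqrt (Psi α c s t (l : ℂ)).det.re : ℝ) : ℂ)⁻¹ • Psi α c s t (l : ℂ)

end Date

/-- `P' = P A` (derivative in `s`) and `∂ₜ P = P B`, entrywise. -/
def SolvesLaxPair (P A B : ℝ → ℝ → Matrix (Fin 2) (Fin 2) ℂ) : Prop :=
  ∀ s t : ℝ, ∀ i j : Fin 2,
    HasDerivAt (fun x : ℝ => P x t i j) ((P s t * A s t) i j) s ∧
    HasDerivAt (fun y : ℝ => P s y i j) ((P s t * B s t) i j) t

/-- `q` is a smooth solution of the Pohlmeyer-Lund-Regge equation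
`∂ₛ∂ₜ q + (1/2) q ∫ˢ ∂ₜ|q|² ds = 0`, where `h` is the chosen antiderivative `∫ˢ ∂ₜ|q|² ds`. -/
def IsPLRSolution (q : ℝ → ℝ → ℂ) (h : ℝ → ℝ → ℝ) : Prop :=
  ContDiff ℝ ∞ (fun p : ℝ × ℝ => q p.1 p.2) ∧
  (∀ s t : ℝ, HasDerivAt (fun x : ℝ => h x t) (deriv (fun y : ℝ => ‖q s y‖ ^ 2) t) s) ∧
  ∀ s t : ℝ, deriv (fun x : ℝ => deriv (fun y : ℝ => q x y) t) s
    + 1 / 2 * q s t * (h s t : ℂ) = 0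

/-- The `s`-coefficient of the Lax pair of the Pohlmeyer-Lund-Regge equation. -/
def laxL (q : ℝ → ℝ → ℂ) (l s t : ℝ) : Matrix (Fin 2) (Fin 2) ℂ :=
  (1 / 2 : ℂ) • !![Complex.I * (l : ℂ), q s t; -conj (q s t), -(Complex.I * (l : ℂ))]

/-- The `t`-coefficient of the Lax pair of the Pohlmeyer-Lund-Regge equation. The equation says
that `-Re (∂ₛ∂ₜ q / q) = h / 2` wherever `q ≠ 0`; the right-hand side makes sense everywhere. -/
def laxM (q : ℝ → ℝ → ℂ) (h : ℝ → ℝ → ℝ) (l s t : ℝ) : Matrix (Fin 2) (Fin 2) ℂ :=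
  (Complex.I / (2 * (l : ℂ))) •
    !![(h s t : ℂ) / 2, -deriv (fun y : ℝ => q s y) t;
      -conj (deriv (fun y : ℝ => q s y) t), -((h s t : ℂ) / 2)]

/-- The identification of `ℝ³` with `𝔰𝔲(2)`. -/
def su2OfR3 (v : Fin 3 → ℝ) : Matrix (Fin 2) (Fin 2) ℂ :=
  (1 / 2 : ℂ) • !![Complex.I * (v 2 : ℂ), -(v 0 : ℂ) - Complex.I * (v 1 : ℂ);
    (v 0 : ℂ) - Complex.I * (v 1 : ℂ), -(Complex.I * (v 2 : ℂ))]

/-- The inverse on `𝔰𝔲(2)` of the identification `su2OfR3`. -/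
def r3OfSu2 (X : Matrix (Fin 2) (Fin 2) ℂ) : Fin 3 → ℝ :=
  ![2 * (X 1 0).re, -2 * (X 1 0).im, 2 * (X 0 0).im]

/-- The Sym formula `λ (∂_λ F) F⁻¹` at `λ = 1`. -/
def symFormula (F : ℝ → ℝ → ℝ → Matrix (Fin 2) (Fin 2) ℂ) (s t : ℝ) :
    Matrix (Fin 2) (Fin 2) ℂ :=
  (Matrix.of fun i j => deriv (fun l : ℝ => F s t l i j) 1) * (F s t 1)⁻¹

/-- The `N`-soliton curve `γ`: the Sym formula for the normalized Date wave function, read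
in `ℝ³`. -/
def solitonCurve {N : ℕ} (α c : Fin N → ℂ) (s t : ℝ) : Fin 3 → ℝ :=
  r3OfSu2 (symFormula (frame α c) s t)

/-- `γ` is a (smooth) Lund-Regge evolution, `∂ₜ γ' = γ' × ∂ₜ γ`. -/
def IsLundReggeEvolution (γ : ℝ → ℝ → Fin 3 → ℝ) : Prop :=
  ContDiff ℝ ∞ (fun p : ℝ × ℝ => γ p.1 p.2) ∧
  ∀ s t : ℝ, deriv (fun y : ℝ => deriv (fun x : ℝ => γ x y) s) t =
    crossProduct (deriv (fun x : ℝ => γ x t) s) (deriv (fun y : ℝ => γ s y) t)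

/-- `γ` has unit speed in `s` for the Euclidean norm. -/
def HasUnitSpeed (γ : ℝ → ℝ → Fin 3 → ℝ) : Prop :=
  ∀ s t : ℝ, ‖WithLp.toLp 2 (deriv (fun x : ℝ => γ x t) s)‖ = 1

end LundRegge

end

/-!
With the exponentials stripped, the first column of Date's wave function is a pair of polynomials
`(f, g)` with `f` monic of degree `N` and `deg g < N`, and `d₀` is the determinant of the `2N`
linear conditions on their coefficients. Writing `*` for the conjugation of coefficients, these say
that `!![f, -g*; g, f*]` is annihilated from the left by a nonzero row vector at each `αⱼ`, so that
its determinant `f f* + g g*` is divisible by `∏ⱼ (λ - αⱼ)(λ - conj αⱼ)`. By degree it is a constant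
multiple of that product; the constant is `1` for the normalized pair, which gives `det Ψ`, and `0`
for a solution of the homogeneous conditions, where positivity of `|f|² + |g|²` on the real line
forces `f = g = 0`, which gives `d₀ ≠ 0`.

The derivatives of a solution satisfy the same conditions (after multiplying by `λ` in the case of
`∂ₜ`), so by uniqueness they are constant combinations of the two columns, whose coefficients are
read off from the leading and the constant terms: this is the Lax pair. The induced `s`-flow of the
constant terms of `f` and `g` is the Pohlmeyer-Lund-Regge equation. For `γ = λ (∂F/∂λ) F⁻¹` at
`λ = 1` the Lax pair `F' = F L`, `Ḟ = F M` gives `γ' = F B F⁻¹` with `B = diag (i/2, -i/2)` and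
`γ̇ = -F M F⁻¹`, whence `γ̇' = F [M, B] F⁻¹ = [γ', γ̇]`, the Lund-Regge equation in `𝔰𝔲(2)`.
-/

namespace LundRegge

open Polynomial
open scoped Matrix Topology

/-! ### The exponential -/

theorem expFun_ne_zero (s t : ℝ) (l : ℂ) : expFun s t l ≠ 0 := Complex.exp_ne_zero _

theorem expFun_neg (s t : ℝ) (l : ℂ) : expFun s t (-l) = (expFun s t l)⁻¹ := by
  rw [expFun, expFun, ← Complex.exp_neg, inv_neg]
  congr 1
  ring

theorem conj_expFun (s t : ℝ) (l : ℂ) : conj (expFun s t l) = (expFun s t (conj l))⁻¹ := by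
  rw [expFun, expFun, ← Complex.exp_neg, ← Complex.exp_conj]
  congr 1
  simp only [map_mul, map_add, map_div₀, Complex.conj_I, Complex.conj_ofReal, map_inv₀,
    map_ofNat]
  ring

theorem hasDerivAt_expFun_fst (s t : ℝ) (l : ℂ) :
    HasDerivAt (fun x => expFun x t l) (Complex.I / 2 * l * expFun s t l) s := by
  unfold expFun
  have hs : HasDerivAt (fun x : ℝ => (x : ℂ)) 1 s := Complex.ofRealCLM.hasDerivAt
  convert (((hs.const_mul l).add_const (l⁻¹ * (t : ℂ))).const_mul (Complex.I / 2)).cexp using 1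
  ring

theorem hasDerivAt_expFun_snd (s t : ℝ) (l : ℂ) :
    HasDerivAt (fun y => expFun s y l) (Complex.I / 2 * l⁻¹ * expFun s t l) t := by
  unfold expFun
  have ht : HasDerivAt (fun y : ℝ => (y : ℂ)) 1 t := Complex.ofRealCLM.hasDerivAt
  convert (((ht.const_mul l⁻¹).const_add (l * (s : ℂ))).const_mul (Complex.I / 2)).cexp using 1
  ring

theorem contDiff_expFun (l : ℂ) : ContDiff ℝ ∞ fun p : ℝ × ℝ => expFun p.1 p.2 l := by
  have hofReal := Complex.ofRealCLM.contDiff (n := ∞)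
  unfold expFun
  exact (contDiff_const.mul ((contDiff_const.mul (hofReal.comp contDiff_fst)).add
    (contDiff_const.mul (hofReal.comp contDiff_snd)))).cexp

/-! ### Conjugate polynomials and the norm form -/

/-- The polynomial `p*` with conjugated coefficients, `p*(z) = conj (p (conj z))`. -/
noncomputable def conjPoly : ℂ[X] →+* ℂ[X] := mapRingHom (starRingEnd ℂ)

@[simp]
theorem coeff_conjPoly (p : ℂ[X]) (n : ℕ) : (conjPoly p).coeff n = conj (p.coeff n) :=
  coeff_map _ _

@[simp]
theorem eval_conjPoly (p : ℂ[X]) (z : ℂ) : (conjPoly p).eval z = conj (p.eval (conj z)) := by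
  have := eval_map_apply (f := starRingEnd ℂ) (p := p) (conj z)
  rwa [Complex.conj_conj] at this

@[simp]
theorem conjPoly_conjPoly (p : ℂ[X]) : conjPoly (conjPoly p) = p := by
  ext n
  simp

@[simp]
theorem conjPoly_C (a : ℂ) : conjPoly (C a) = C (conj a) := map_C _

@[simp]
theorem conjPoly_X : conjPoly X = X := map_X _

@[simp]
theorem natDegree_conjPoly (p : ℂ[X]) : (conjPoly p).natDegree = p.natDegree :=
  natDegree_map _

/-- The norm `p p* + q q*` of the quaternionic polynomial matrix `!![p, -q*; q, p*]`. -/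
noncomputable def normPoly (p q : ℂ[X]) : ℂ[X] := p * conjPoly p + q * conjPoly q

theorem conjPoly_normPoly (p q : ℂ[X]) : conjPoly (normPoly p q) = normPoly p q := by
  simp only [normPoly, map_add, map_mul, conjPoly_conjPoly]
  ring

theorem eval_normPoly_ofReal (p q : ℂ[X]) (x : ℝ) :
    (normPoly p q).eval (x : ℂ) = ((‖p.eval (x : ℂ)‖ ^ 2 + ‖q.eval (x : ℂ)‖ ^ 2 : ℝ) : ℂ) := by
  simp [normPoly, Complex.mul_conj']

theorem natDegree_normPoly_le {p q : ℂ[X]} {n : ℕ} (hp : p.natDegree ≤ n) (hq : q.natDegree ≤ n) :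
    (normPoly p q).natDegree ≤ n + n :=
  natDegree_add_le_of_degree_le
    (natDegree_mul_le_of_le hp ((natDegree_conjPoly p).trans_le hp))
    (natDegree_mul_le_of_le hq ((natDegree_conjPoly q).trans_le hq))

theorem coeff_normPoly {p q : ℂ[X]} {n : ℕ} (hp : p.natDegree ≤ n) (hq : q.natDegree ≤ n) :
    (normPoly p q).coeff (n + n) =
      p.coeff n * conj (p.coeff n) + q.coeff n * conj (q.coeff n) := by
  rw [normPoly, coeff_add,
    coeff_mul_add_eq_of_natDegree_le hp ((natDegree_conjPoly p).trans_le hp),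
    coeff_mul_add_eq_of_natDegree_le hq ((natDegree_conjPoly q).trans_le hq),
    coeff_conjPoly, coeff_conjPoly]

theorem normPoly_eq_zero_iff {p q : ℂ[X]} : normPoly p q = 0 ↔ p = 0 ∧ q = 0 := by
  refine ⟨fun h => ?_, by rintro ⟨rfl, rfl⟩; simp [normPoly]⟩
  have hreal (x : ℝ) : p.eval (x : ℂ) = 0 ∧ q.eval (x : ℂ) = 0 := by
    have hx := eval_normPoly_ofReal p q x
    rw [h, eval_zero, eq_comm, Complex.ofReal_eq_zero] at hx
    exact ⟨by simpa using (show ‖p.eval (x : ℂ)‖ ^ 2 = 0 by nlinarith),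
      by simpa using (show ‖q.eval (x : ℂ)‖ ^ 2 = 0 by nlinarith)⟩
  have hinf : (Set.range ((↑) : ℝ → ℂ)).Infinite :=
    Set.infinite_range_of_injective Complex.ofReal_injective
  exact ⟨eq_zero_of_infinite_isRoot _ (hinf.mono (by rintro _ ⟨x, rfl⟩; exact (hreal x).1)),
    eq_zero_of_infinite_isRoot _ (hinf.mono (by rintro _ ⟨x, rfl⟩; exact (hreal x).2))⟩

/-! ### The interpolation problem -/

section Interpolation

variable {N : ℕ} {α u v : Fin N → ℂ} {p q f g : ℂ[X]}

/-- The points `α_j` together with their conjugates: the zeros of `det Ψ`. -/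
def nodes (α : Fin N → ℂ) : Fin N ⊕ Fin N → ℂ := Sum.elim α fun j => conj (α j)

theorem nodes_injective (hα : Function.Injective α) (hconj : ∀ j k, α j ≠ conj (α k)) :
    Function.Injective (nodes α) :=
  hα.sumElim ((starRingEnd ℂ).injective.comp hα) hconj

theorem ofReal_ne_nodes (hα : Function.Injective (nodes α)) (x : ℝ) (i : Fin N ⊕ Fin N) :
    (x : ℂ) ≠ nodes α i := by
  have hconj (j : Fin N) : α j ≠ conj (α j) :=
    hα.ne (a₁ := .inl j) (a₂ := .inr j) Sum.inl_ne_inr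
  rcases i with j | j <;> intro hx
  · exact hconj j (by simp [← show (x : ℂ) = α j from hx])
  · have hαx : conj (α j) = x := hx.symm
    exact hconj j (by rw [← Complex.conj_conj (α j), hαx, Complex.conj_ofReal, Complex.conj_ofReal])

/-- The monic polynomial with simple zeros at the `nodes`. -/
noncomputable def nodePoly (α : Fin N → ℂ) : ℂ[X] := Lagrange.nodal Finset.univ (nodes α)

/-- The values `∏ |x - α_j|²` of `nodePoly` on the real line. -/
noncomputable def nodeNorm (α : Fin N → ℂ) (x : ℝ) : ℝ := ∏ j, ‖(x : ℂ) - α j‖ ^ 2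

theorem eval_nodePoly_ofReal (α : Fin N → ℂ) (x : ℝ) :
    (nodePoly α).eval (x : ℂ) = (nodeNorm α x : ℂ) := by
  rw [nodePoly, Lagrange.eval_nodal, Fintype.prod_sum_type, ← Finset.prod_mul_distrib, nodeNorm]
  push_cast
  refine Finset.prod_congr rfl fun j _ => ?_
  rw [← Complex.mul_conj', map_sub, Complex.conj_ofReal]
  rfl

theorem nodeNorm_pos (hα : Function.Injective (nodes α)) (x : ℝ) : 0 < nodeNorm α x :=
  Finset.prod_pos fun j _ =>
    pow_pos (norm_pos_iff.2 (sub_ne_zero.2 (ofReal_ne_nodes hα x (.inl j)))) 2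

theorem contDiff_nodeNorm (α : Fin N → ℂ) : ContDiff ℝ ∞ (nodeNorm α) :=
  contDiff_prod fun _ _ => (Complex.ofRealCLM.contDiff.sub contDiff_const).norm_sq ℝ

/-- The pairs `(p, q)` for which the row vector `(u_j, v_j)` annihilates the quaternionic matrix
`!![p, -q*; q, p*]` at `α_j`, for every `j`. -/
noncomputable def dateModule (α u v : Fin N → ℂ) : Submodule ℂ[X] (ℂ[X] × ℂ[X]) where
  carrier := {w | ∀ j, u j * w.1.eval (α j) + v j * w.2.eval (α j) = 0 ∧
    v j * (conjPoly w.1).eval (α j) - u j * (conjPoly w.2).eval (α j) = 0}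
  add_mem' {w w'} hw hw' j := by
    simp only [Prod.fst_add, Prod.snd_add, map_add, eval_add]
    exact ⟨by linear_combination (hw j).1 + (hw' j).1, by linear_combination (hw j).2 + (hw' j).2⟩
  zero_mem' j := by simp
  smul_mem' r w hw j := by
    simp only [Prod.smul_fst, Prod.smul_snd, smul_eq_mul, map_mul, eval_mul]
    exact ⟨by linear_combination r.eval (α j) * (hw j).1,
      by linear_combination (conjPoly r).eval (α j) * (hw j).2⟩

theorem mem_dateModule : (p, q) ∈ dateModule α u v ↔
    ∀ j, u j * p.eval (α j) + v j * q.eval (α j) = 0 ∧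
      v j * (conjPoly p).eval (α j) - u j * (conjPoly q).eval (α j) = 0 :=
  Iff.rfl

theorem partner_mem_dateModule (h : (p, q) ∈ dateModule α u v) :
    (-conjPoly q, conjPoly p) ∈ dateModule α u v := by
  refine mem_dateModule.2 fun j => ?_
  obtain ⟨hp, hq⟩ := mem_dateModule.1 h j
  simp only [map_neg, conjPoly_conjPoly, eval_neg]
  exact ⟨by linear_combination hq, by linear_combination -hp⟩

theorem nodePoly_dvd_normPoly (hα : Function.Injective (nodes α)) (hu : ∀ j, u j ≠ 0)
    (h : (p, q) ∈ dateModule α u v) : nodePoly α ∣ normPoly p q := by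
  have hroot (j : Fin N) : (normPoly p q).eval (α j) = 0 := by
    obtain ⟨hp, hq⟩ := mem_dateModule.1 h j
    refine (mul_eq_zero.1 ?_).resolve_left (hu j)
    simp only [normPoly, eval_add, eval_mul]
    linear_combination (conjPoly p).eval (α j) * hp - q.eval (α j) * hq
  rw [nodePoly, Lagrange.nodal_eq]
  refine Fintype.prod_dvd_of_coprime (pairwise_coprime_X_sub_C hα) fun i => dvd_iff_isRoot.2 ?_
  rcases i with j | j
  · exact hroot j
  · change (normPoly p q).eval (conj (α j)) = 0
    rw [← conjPoly_normPoly, eval_conjPoly, Complex.conj_conj, hroot j, map_zero]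

theorem normPoly_eq_C_mul_nodePoly (hα : Function.Injective (nodes α)) (hu : ∀ j, u j ≠ 0)
    (h : (p, q) ∈ dateModule α u v) (hp : p.natDegree ≤ N) (hq : q.natDegree ≤ N) :
    normPoly p q =
      C (p.coeff N * conj (p.coeff N) + q.coeff N * conj (q.coeff N)) * nodePoly α := by
  have hmonic : (nodePoly α).Monic := Lagrange.nodal_monic
  have hdeg : (nodePoly α).natDegree = N + N := by simp [nodePoly]
  have heq := eq_leadingCoeff_mul_of_monic_of_dvd_of_natDegree_le hmonic
    (nodePoly_dvd_normPoly hα hu h) ((natDegree_normPoly_le hp hq).trans_eq hdeg.symm)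
  have hlead : (normPoly p q).coeff (N + N) = (normPoly p q).leadingCoeff := by
    conv_lhs => rw [heq, ← hdeg, coeff_C_mul, hmonic.coeff_natDegree, mul_one]
  rw [← coeff_normPoly hp hq, hlead]
  exact heq

theorem eq_zero_of_mem_dateModule (hα : Function.Injective (nodes α)) (hu : ∀ j, u j ≠ 0)
    (h : (p, q) ∈ dateModule α u v) (hp : p.natDegree ≤ N) (hq : q.natDegree ≤ N)
    (hpN : p.coeff N = 0) (hqN : q.coeff N = 0) : p = 0 ∧ q = 0 := by
  rw [← normPoly_eq_zero_iff, normPoly_eq_C_mul_nodePoly hα hu h hp hq, hpN, hqN]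
  simp

/-- A solution of the interpolation problem of degree `N`, with leading coefficients normalized to
`(1, 0)`. It is the first column of Date's wave function. -/
structure IsDateSolution (α u v : Fin N → ℂ) (f g : ℂ[X]) : Prop where
  mem : (f, g) ∈ dateModule α u v
  natDegree_fst_le : f.natDegree ≤ N
  natDegree_snd_le : g.natDegree ≤ N
  coeff_fst : f.coeff N = 1
  coeff_snd : g.coeff N = 0

namespace IsDateSolution

theorem normPoly_eq (hf : IsDateSolution α u v f g) (hα : Function.Injective (nodes α))
    (hu : ∀ j, u j ≠ 0) : normPoly f g = nodePoly α := by
  rw [normPoly_eq_C_mul_nodePoly hα hu hf.mem hf.natDegree_fst_le hf.natDegree_snd_le,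
    hf.coeff_fst, hf.coeff_snd]
  simp

theorem norm_sq_eval_ofReal (hf : IsDateSolution α u v f g) (hα : Function.Injective (nodes α))
    (hu : ∀ j, u j ≠ 0) (x : ℝ) :
    ‖f.eval (x : ℂ)‖ ^ 2 + ‖g.eval (x : ℂ)‖ ^ 2 = nodeNorm α x := by
  have h := eval_normPoly_ofReal f g x
  rw [hf.normPoly_eq hα hu, eval_nodePoly_ofReal] at h
  exact (Complex.ofReal_injective h).symm

theorem eq_combination (hf : IsDateSolution α u v f g) (hα : Function.Injective (nodes α))
    (hu : ∀ j, u j ≠ 0) (h : (p, q) ∈ dateModule α u v) (hp : p.natDegree ≤ N)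
    (hq : q.natDegree ≤ N) :
    p = C (p.coeff N) * f - C (q.coeff N) * conjPoly g ∧
      q = C (p.coeff N) * g + C (q.coeff N) * conjPoly f := by
  have hmem := sub_mem h (add_mem (Submodule.smul_mem _ (C (p.coeff N)) hf.mem)
    (Submodule.smul_mem _ (C (q.coeff N)) (partner_mem_dateModule hf.mem)))
  have hdeg {a b : ℂ} {r r' : ℂ[X]} (hr : r.natDegree ≤ N) (hr' : r'.natDegree ≤ N) :
      (C a * r + C b * r').natDegree ≤ N :=
    natDegree_add_le_of_degree_le ((natDegree_C_mul_le _ _).trans hr)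
      ((natDegree_C_mul_le _ _).trans hr')
  simp only [Prod.smul_mk, Prod.mk_add_mk, Prod.mk_sub_mk, smul_eq_mul] at hmem
  obtain ⟨h₁, h₂⟩ := eq_zero_of_mem_dateModule hα hu hmem
    (natDegree_sub_le_of_le hp (hdeg hf.natDegree_fst_le
      (by simpa using hf.natDegree_snd_le)) |>.trans_eq (max_self N))
    (natDegree_sub_le_of_le hq (hdeg hf.natDegree_snd_le
      (by simpa using hf.natDegree_fst_le)) |>.trans_eq (max_self N))
    (by simp [hf.coeff_fst, hf.coeff_snd]) (by simp [hf.coeff_fst, hf.coeff_snd])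
  exact ⟨by linear_combination h₁, by linear_combination h₂⟩

end IsDateSolution

end Interpolation

/-! ### The determinants -/

theorem conj_det_fromBlocks_conj {n : Type*} [Fintype n] [DecidableEq n] (A B : Matrix n n ℂ) :
    conj (Matrix.fromBlocks A (-B) (B.map conj) (A.map conj)).det =
      (Matrix.fromBlocks A (-B) (B.map conj) (A.map conj)).det := by
  set T := Matrix.fromBlocks A (-B) (B.map conj) (A.map conj)
  -- Conjugation by `J` is multiplication by the quaternion unit `j`.
  have hJT : Matrix.J n ℂ * T = (starRingEnd ℂ).mapMatrix T * Matrix.J n ℂ := by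
    simp only [T, Matrix.J, RingHom.mapMatrix_apply, Matrix.fromBlocks_map,
      Matrix.fromBlocks_multiply]
    congr 1 <;> ext i j <;> simp
  have hdet := congrArg Matrix.det hJT
  rw [Matrix.det_mul, Matrix.det_mul, ← RingHom.map_det, mul_comm] at hdet
  exact ((Matrix.isUnit_det_J n ℂ).mul_right_cancel hdet).symm

theorem eval_ofFn {R : Type*} [CommSemiring R] [DecidableEq R] {n : ℕ} (v : Fin n → R) (z : R) :
    (ofFn n v).eval z = ∑ j : Fin n, v j * z ^ (j : ℕ) := by
  simp only [ofFn_eq_sum_monomial, eval_finsetSum, eval_monomial]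

section Determinants

variable {N : ℕ} (α c : Fin N → ℂ)

/-- With `weightSnd`, the row vector `(1, c_j) diag(e(α_j), e(α_j)⁻¹)`. -/
noncomputable def weightFst (s t : ℝ) (j : Fin N) : ℂ := expFun s t (α j)

/-- See `weightFst`. -/
noncomputable def weightSnd (s t : ℝ) (j : Fin N) : ℂ := c j * (expFun s t (α j))⁻¹

theorem blockEA_mulVec (s t : ℝ) (v : Fin N → ℂ) (j : Fin N) :
    (blockEA α s t).mulVec v j = weightFst α s t j * (ofFn N v).eval (α j) := by
  simp [blockEA, weightFst, eval_ofFn, Matrix.mulVec, dotProduct, Matrix.diagonal_mul,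
    Matrix.vandermonde_apply, Finset.mul_sum, mul_assoc, mul_comm (v _)]

theorem blockCEA_mulVec (s t : ℝ) (v : Fin N → ℂ) (j : Fin N) :
    (blockCEA α c s t).mulVec v j = weightSnd α c s t j * (ofFn N v).eval (α j) := by
  simp [blockCEA, weightSnd, eval_ofFn, Matrix.mulVec, dotProduct, Matrix.diagonal_mul,
    Matrix.vandermonde_apply, Finset.mul_sum, mul_assoc, mul_comm (v _)]

theorem conj_mulVec (A : Matrix (Fin N) (Fin N) ℂ) (v : Fin N → ℂ) (j : Fin N) :
    (A.map conj).mulVec v j = conj (A.mulVec (fun k => conj (v k)) j) := by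
  simp [Matrix.mulVec, dotProduct]

theorem conjPoly_ofFn (v : Fin N → ℂ) : conjPoly (ofFn N v) = ofFn N fun j => conj (v j) := by
  ext n
  rw [coeff_conjPoly]
  rcases lt_or_ge n N with h | h
  · rw [ofFn_coeff_eq_val_of_lt _ h, ofFn_coeff_eq_val_of_lt _ h]
  · rw [ofFn_coeff_eq_zero_of_ge _ h, ofFn_coeff_eq_zero_of_ge _ h, map_zero]

theorem coeffMatrix_mulVec (s t : ℝ) (v w : Fin N → ℂ) :
    (coeffMatrix α c s t).mulVec (Sum.elim v w) = Sum.elim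
      (fun j => weightFst α s t j * (ofFn N v).eval (α j) -
        weightSnd α c s t j * (ofFn N w).eval (α j))
      fun j => conj (weightSnd α c s t j * (conjPoly (ofFn N v)).eval (α j) +
        weightFst α s t j * (conjPoly (ofFn N w)).eval (α j)) := by
  rw [coeffMatrix, Matrix.fromBlocks_mulVec, Sum.elim_comp_inl, Sum.elim_comp_inr]
  congr 1 <;> ext j
  · rw [Pi.add_apply, Matrix.neg_mulVec, Pi.neg_apply, blockEA_mulVec, blockCEA_mulVec,
      sub_eq_add_neg]
  · rw [Pi.add_apply, conj_mulVec, conj_mulVec, blockEA_mulVec, blockCEA_mulVec, conjPoly_ofFn,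
      conjPoly_ofFn, map_add]

theorem rhsVec_eq (s t : ℝ) : rhsVec α c s t = Sum.elim
    (fun j => -(weightFst α s t j * α j ^ N))
    fun j => -conj (weightSnd α c s t j * α j ^ N) := by
  rw [rhsVec]
  congr 1 <;> ext j
  · rw [weightFst, mul_comm]
  · rw [weightSnd, map_mul, map_mul, map_inv₀, conj_expFun, inv_inv, map_pow]
    ring

variable {α c}

theorem ofFn_mem_dateModule_iff {s t : ℝ} {v w : Fin N → ℂ} :
    (ofFn N v, -ofFn N w) ∈ dateModule α (weightFst α s t) (weightSnd α c s t) ↔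
      (coeffMatrix α c s t).mulVec (Sum.elim v w) = 0 := by
  rw [coeffMatrix_mulVec, mem_dateModule, forall_and, ← Sum.elim_zero_zero, Sum.elim_eq_iff,
    funext_iff, funext_iff]
  simp only [Pi.zero_apply, map_eq_zero, map_neg, eval_neg, mul_neg, sub_neg_eq_add,
    ← sub_eq_add_neg]

theorem X_pow_add_ofFn_mem_dateModule_iff {s t : ℝ} {v w : Fin N → ℂ} :
    (X ^ N + ofFn N v, -ofFn N w) ∈ dateModule α (weightFst α s t) (weightSnd α c s t) ↔
      (coeffMatrix α c s t).mulVec (Sum.elim v w) = rhsVec α c s t := by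
  rw [coeffMatrix_mulVec, rhsVec_eq, mem_dateModule, forall_and, Sum.elim_eq_iff, funext_iff,
    funext_iff]
  simp only [← map_neg, (starRingEnd ℂ).injective.eq_iff]
  simp only [map_add, map_pow, conjPoly_X, map_neg, eval_add, eval_neg, eval_pow, eval_X]
  refine and_congr (forall_congr' fun j => ?_) (forall_congr' fun j => ?_) <;>
    constructor <;> intro h <;> linear_combination h

theorem colNumber_injective : Function.Injective (colNumber (N := N)) := by
  rintro (j | j) (k | k) h <;> simp only [colNumber, Sum.elim_inl, Sum.elim_inr] at h
  · exact congrArg _ (Fin.ext (by omega))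
  · omega
  · omega
  · exact congrArg _ (Fin.ext (by omega))

variable (α c) in
theorem d_colNumber (s t : ℝ) (k : Fin N ⊕ Fin N) :
    d α c (colNumber k) s t = (coeffMatrix α c s t).cramer (rhsVec α c s t) k := by
  rw [d, Matrix.cramer_apply]
  congr 1
  ext i j
  simp only [cramerMatrix, Matrix.of_apply, Matrix.updateCol_apply, colNumber_injective.eq_iff]

variable (α c) in
theorem d_zero (s t : ℝ) : d α c 0 s t = (coeffMatrix α c s t).det := by
  rw [d]
  congr 1
  ext i j
  rw [cramerMatrix, Matrix.of_apply, if_neg]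
  rcases j with j | j <;> simp [colNumber]

theorem conj_d_zero (s t : ℝ) : conj (d α c 0 s t) = d α c 0 s t := by
  rw [d_zero]
  exact conj_det_fromBlocks_conj _ _

theorem weightFst_ne_zero (s t : ℝ) (j : Fin N) : weightFst α s t j ≠ 0 := expFun_ne_zero _ _ _

theorem d_zero_ne_zero (hα : Function.Injective (nodes α)) (s t : ℝ) : d α c 0 s t ≠ 0 := by
  rw [d_zero]
  intro hdet
  obtain ⟨x, hx, hker⟩ := Matrix.exists_mulVec_eq_zero_iff.2 hdet
  rw [← Sum.elim_comp_inl_inr x] at hx hker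
  have hcoeff (v : Fin N → ℂ) : (ofFn N v).coeff N = 0 := ofFn_coeff_eq_zero_of_ge v le_rfl
  have hdeg (v : Fin N → ℂ) : (ofFn N v).natDegree ≤ N :=
    natDegree_le_of_degree_le (ofFn_degree_lt v).le
  obtain ⟨hv, hw⟩ := eq_zero_of_mem_dateModule hα (weightFst_ne_zero s t)
    (ofFn_mem_dateModule_iff.2 hker) (hdeg _) ((natDegree_neg _).trans_le (hdeg _)) (hcoeff _)
    (by rw [coeff_neg, hcoeff, neg_zero])
  have hinj (v : Fin N → ℂ) (hv : ofFn N v = 0) : v = 0 := by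
    ext j
    rw [← ofFn_coeff_eq_val_of_lt v j.2, hv, coeff_zero, Pi.zero_apply]
  apply hx
  rw [hinj _ hv, hinj _ (neg_eq_zero.1 hw), Sum.elim_zero_zero]

variable (α c) in
/-- The polynomial `f(s, t, ·)`. -/
noncomputable def fPoly (s t : ℝ) : ℂ[X] :=
  X ^ N + ofFn N fun j => d α c (j + 1) s t / d α c 0 s t

variable (α c) in
/-- The polynomial `g(s, t, ·)`. -/
noncomputable def gPoly (s t : ℝ) : ℂ[X] :=
  -ofFn N fun j => d α c (N + j + 1) s t / d α c 0 s t

theorem eval_fPoly (s t : ℝ) (l : ℂ) : (fPoly α c s t).eval l =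
    l ^ N + ∑ j : Fin N, d α c ((j : ℕ) + 1) s t / d α c 0 s t * l ^ (j : ℕ) := by
  rw [fPoly, eval_add, eval_pow, eval_X, eval_ofFn]

theorem eval_gPoly (s t : ℝ) (l : ℂ) : (gPoly α c s t).eval l =
    -∑ j : Fin N, d α c (N + (j : ℕ) + 1) s t / d α c 0 s t * l ^ (j : ℕ) := by
  rw [gPoly, eval_neg, eval_ofFn]

theorem coeff_fPoly (s t : ℝ) {n : ℕ} (hn : n < N) :
    (fPoly α c s t).coeff n = d α c (n + 1) s t / d α c 0 s t := by
  rw [fPoly, coeff_add, coeff_X_pow, if_neg hn.ne, ofFn_coeff_eq_val_of_lt _ hn, zero_add]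

theorem coeff_gPoly (s t : ℝ) {n : ℕ} (hn : n < N) :
    (gPoly α c s t).coeff n = -(d α c (N + n + 1) s t / d α c 0 s t) := by
  rw [gPoly, coeff_neg, ofFn_coeff_eq_val_of_lt _ hn]

theorem isDateSolution (hα : Function.Injective (nodes α)) (s t : ℝ) :
    IsDateSolution α (weightFst α s t) (weightSnd α c s t) (fPoly α c s t) (gPoly α c s t) where
  mem := by
    have hd := d_zero_ne_zero (c := c) hα s t
    refine X_pow_add_ofFn_mem_dateModule_iff.2 (smul_right_injective _ hd ?_)
    have hcramer : d α c 0 s t • Sum.elim (fun j : Fin N => d α c (j + 1) s t / d α c 0 s t)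
        (fun j : Fin N => d α c (N + j + 1) s t / d α c 0 s t) =
          (coeffMatrix α c s t).cramer (rhsVec α c s t) := by
      ext (j | j) <;> rw [← d_colNumber] <;> simp [colNumber, mul_div_cancel₀ _ hd]
    beta_reduce
    rw [← Matrix.mulVec_smul, hcramer, Matrix.mulVec_cramer, d_zero]
  natDegree_fst_le := natDegree_le_of_degree_le <|
    (degree_add_le _ _).trans (max_le (degree_X_pow_le N) (ofFn_degree_lt _).le)
  natDegree_snd_le := natDegree_le_of_degree_le <|
    (degree_neg _).trans_le (ofFn_degree_lt _).le
  coeff_fst := by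
    rw [fPoly, coeff_add, coeff_X_pow_self, ofFn_coeff_eq_zero_of_ge _ le_rfl, add_zero]
  coeff_snd := by rw [gPoly, coeff_neg, ofFn_coeff_eq_zero_of_ge _ le_rfl, neg_zero]

theorem contDiff_weightFst (j : Fin N) :
    ContDiff ℝ ∞ fun p : ℝ × ℝ => weightFst α p.1 p.2 j :=
  contDiff_expFun _

theorem contDiff_weightSnd (j : Fin N) :
    ContDiff ℝ ∞ fun p : ℝ × ℝ => weightSnd α c p.1 p.2 j :=
  contDiff_const.mul ((contDiff_expFun _).inv fun p => expFun_ne_zero p.1 p.2 (α j))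

theorem contDiff_coeffMatrix (i k : Fin N ⊕ Fin N) :
    ContDiff ℝ ∞ fun p : ℝ × ℝ => coeffMatrix α c p.1 p.2 i k := by
  have hEA (j k : Fin N) : ContDiff ℝ ∞ fun p : ℝ × ℝ => blockEA α p.1 p.2 j k := by
    simp only [blockEA, Matrix.diagonal_mul]
    exact (contDiff_weightFst j).mul contDiff_const
  have hCEA (j k : Fin N) : ContDiff ℝ ∞ fun p : ℝ × ℝ => blockCEA α c p.1 p.2 j k := by
    simp only [blockCEA, Matrix.diagonal_mul_diagonal, Matrix.diagonal_mul]
    exact (contDiff_weightSnd j).mul contDiff_const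
  rcases i with j | j <;> rcases k with k | k
  · exact hEA j k
  · exact (hCEA j k).neg
  · exact Complex.conjCLE.contDiff.comp (hCEA j k)
  · exact Complex.conjCLE.contDiff.comp (hEA j k)

theorem contDiff_rhsVec (i : Fin N ⊕ Fin N) :
    ContDiff ℝ ∞ fun p : ℝ × ℝ => rhsVec α c p.1 p.2 i := by
  simp only [rhsVec_eq]
  rcases i with j | j
  · exact ((contDiff_weightFst j).mul contDiff_const).neg
  · exact (Complex.conjCLE.contDiff.comp ((contDiff_weightSnd j).mul contDiff_const)).neg

theorem contDiff_d (k : ℕ) : ContDiff ℝ ∞ fun p : ℝ × ℝ => d α c k p.1 p.2 := by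
  simp only [d, Matrix.det_apply']
  refine ContDiff.sum fun σ _ => contDiff_const.mul (contDiff_prod fun i _ => ?_)
  simp only [cramerMatrix, Matrix.of_apply]
  split_ifs
  · exact contDiff_rhsVec _
  · exact contDiff_coeffMatrix _ _

theorem contDiff_d_div_d_zero (hα : Function.Injective (nodes α)) (k : ℕ) :
    ContDiff ℝ ∞ fun p : ℝ × ℝ => d α c k p.1 p.2 / d α c 0 p.1 p.2 := by
  simp only [div_eq_mul_inv]
  exact (contDiff_d k).mul ((contDiff_d 0).inv fun p => d_zero_ne_zero hα p.1 p.2)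

end Determinants

/-! ### Differentiating the interpolation problem -/

theorem natDegree_X_mul_le_of_coeff_eq_zero {R : Type*} [Semiring R] {p : R[X]} {n : ℕ}
    (hp : p.natDegree ≤ n) (hpn : p.coeff n = 0) : (X * p).natDegree ≤ n := by
  refine natDegree_le_iff_coeff_eq_zero.2 fun m hm => ?_
  obtain ⟨k, rfl⟩ := Nat.exists_eq_add_one_of_ne_zero (Nat.ne_zero_of_lt hm)
  rw [coeff_X_mul]
  rcases (Nat.lt_succ_iff.1 hm).eq_or_lt with rfl | hk
  · exact hpn
  · exact coeff_eq_zero_of_natDegree_lt (hp.trans_lt hk)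

/-- `p'` is the derivative at `x` of the curve of polynomials `p`, coefficient by coefficient. -/
def HasCoeffDerivAt (p : ℝ → ℂ[X]) (p' : ℂ[X]) (x : ℝ) : Prop :=
  ∀ n, HasDerivAt (fun y => (p y).coeff n) (p'.coeff n) x

namespace HasCoeffDerivAt

variable {p : ℝ → ℂ[X]} {p' : ℂ[X]} {x : ℝ}

theorem coeff_eq_zero (h : HasCoeffDerivAt p p' x) {n : ℕ} {a : ℂ} (hn : ∀ y, (p y).coeff n = a) :
    p'.coeff n = 0 := by
  have hd := h n
  simp only [hn] at hd
  exact hd.unique (hasDerivAt_const x a)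

theorem natDegree_le (h : HasCoeffDerivAt p p' x) {n : ℕ} (hp : ∀ y, (p y).natDegree ≤ n) :
    p'.natDegree ≤ n :=
  natDegree_le_iff_coeff_eq_zero.2 fun _ hm =>
    h.coeff_eq_zero fun y => coeff_eq_zero_of_natDegree_lt ((hp y).trans_lt hm)

theorem conjPoly (h : HasCoeffDerivAt p p' x) :
    HasCoeffDerivAt (fun y => conjPoly (p y)) (LundRegge.conjPoly p') x := fun n => by
  simp only [coeff_conjPoly]
  exact (h n).star

theorem eval (h : HasCoeffDerivAt p p' x) {n : ℕ} (hp : ∀ y, (p y).natDegree ≤ n) (z : ℂ) :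
    HasDerivAt (fun y => (p y).eval z) (p'.eval z) x := by
  have hsum {r : ℂ[X]} (hr : r.natDegree ≤ n) :=
    eval_eq_sum_range' (p := r) (Nat.lt_succ_of_le hr) z
  simp only [hsum (hp _), hsum (h.natDegree_le hp)]
  exact HasDerivAt.fun_sum fun m _ => (h m).mul_const _

end HasCoeffDerivAt

theorem exists_hasCoeffDerivAt {p : ℝ → ℂ[X]} {x : ℝ} {n : ℕ} (hp : ∀ y, (p y).natDegree ≤ n)
    (hd : ∀ m, DifferentiableAt ℝ (fun y => (p y).coeff m) x) :
    ∃ p', HasCoeffDerivAt p p' x := by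
  refine ⟨ofFn (n + 1) fun m => deriv (fun y => (p y).coeff m) x, fun m => ?_⟩
  rcases lt_or_ge m (n + 1) with hm | hm
  · rw [ofFn_coeff_eq_val_of_lt _ hm]
    exact (hd m).hasDerivAt
  · simp only [ofFn_coeff_eq_zero_of_ge _ hm, coeff_eq_zero_of_natDegree_lt ((hp _).trans_lt hm)]
    exact hasDerivAt_const x 0

/-- A curve of solutions `(f y, g y)` of the interpolation problem with weights evolving like
`exp (± κ_j y)`, together with the derivatives `f'`, `g'` of the solutions at `x`. -/
structure IsDateFlow {N : ℕ} (α κ : Fin N → ℂ) (u v : ℝ → Fin N → ℂ) (f g : ℝ → ℂ[X])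
    (f' g' : ℂ[X]) (x : ℝ) : Prop where
  isDateSolution : ∀ y, IsDateSolution α (u y) (v y) (f y) (g y)
  hasDerivAt_fst : ∀ j, HasDerivAt (fun y => u y j) (κ j * u x j) x
  hasDerivAt_snd : ∀ j, HasDerivAt (fun y => v y j) (-κ j * v x j) x
  hasCoeffDerivAt_fst : HasCoeffDerivAt f f' x
  hasCoeffDerivAt_snd : HasCoeffDerivAt g g' x

/-- The diagonal coefficient `(|f₀|² - |g₀|²) / (|f₀|² + |g₀|²)` of the `t`-flow. -/
noncomputable def diagCoeff {N : ℕ} (α : Fin N → ℂ) (f g : ℂ[X]) : ℝ :=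
  (‖f.coeff 0‖ ^ 2 - ‖g.coeff 0‖ ^ 2) / nodeNorm α 0

/-- The off-diagonal coefficient `f₀ g₀ / (|f₀|² + |g₀|²)` of the `t`-flow. -/
noncomputable def offDiagCoeff {N : ℕ} (α : Fin N → ℂ) (f g : ℂ[X]) : ℂ :=
  f.coeff 0 * g.coeff 0 / nodeNorm α 0

section Flow

variable {N : ℕ} {α κ : Fin N → ℂ}

theorem IsDateSolution.norm_sq_coeff_zero {u v : Fin N → ℂ} {f g : ℂ[X]}
    (hf : IsDateSolution α u v f g) (hα : Function.Injective (nodes α)) (hu : ∀ j, u j ≠ 0) :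
    ‖f.coeff 0‖ ^ 2 + ‖g.coeff 0‖ ^ 2 = nodeNorm α 0 := by
  simpa only [coeff_zero_eq_eval_zero, Complex.ofReal_zero] using hf.norm_sq_eval_ofReal hα hu 0

namespace IsDateFlow

variable {u v : ℝ → Fin N → ℂ} {f g : ℝ → ℂ[X]} {f' g' : ℂ[X]} {x : ℝ}

theorem natDegree_fst_le (h : IsDateFlow α κ u v f g f' g' x) : f'.natDegree ≤ N :=
  h.hasCoeffDerivAt_fst.natDegree_le fun y => (h.isDateSolution y).natDegree_fst_le

theorem natDegree_snd_le (h : IsDateFlow α κ u v f g f' g' x) : g'.natDegree ≤ N :=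
  h.hasCoeffDerivAt_snd.natDegree_le fun y => (h.isDateSolution y).natDegree_snd_le

theorem coeff_fst (h : IsDateFlow α κ u v f g f' g' x) : f'.coeff N = 0 :=
  h.hasCoeffDerivAt_fst.coeff_eq_zero fun y => (h.isDateSolution y).coeff_fst

theorem coeff_snd (h : IsDateFlow α κ u v f g f' g' x) : g'.coeff N = 0 :=
  h.hasCoeffDerivAt_snd.coeff_eq_zero fun y => (h.isDateSolution y).coeff_snd

-- Differentiating the interpolation conditions produces the rates `± κ_j`; the polynomials `μ` and
-- `ρ` interpolate `κ_j` as `μ / ρ`.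
theorem deriv_mem_dateModule (h : IsDateFlow α κ u v f g f' g' x) {μ ρ : ℂ[X]}
    (hμ : conjPoly μ = -μ) (hρ : conjPoly ρ = ρ) (hκ : ∀ j, ρ.eval (α j) * κ j = μ.eval (α j)) :
    (μ * f x + ρ * f', -μ * g x + ρ * g') ∈ dateModule α (u x) (v x) := by
  refine mem_dateModule.2 fun j => ?_
  have hf := h.hasCoeffDerivAt_fst
  have hg := h.hasCoeffDerivAt_snd
  have hfdeg y := (h.isDateSolution y).natDegree_fst_le
  have hgdeg y := (h.isDateSolution y).natDegree_snd_le
  have hu := h.hasDerivAt_fst j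
  have hv := h.hasDerivAt_snd j
  have h₁ := (hu.fun_mul (hf.eval hfdeg (α j))).fun_add (hv.fun_mul (hg.eval hgdeg (α j)))
  have h₂ := (hv.fun_mul (hf.conjPoly.eval
    (fun y => (natDegree_conjPoly _).trans_le (hfdeg y)) (α j))).fun_sub
      (hu.fun_mul (hg.conjPoly.eval (fun y => (natDegree_conjPoly _).trans_le (hgdeg y)) (α j)))
  simp only [(mem_dateModule.1 (h.isDateSolution _).mem j).1] at h₁
  simp only [(mem_dateModule.1 (h.isDateSolution _).mem j).2] at h₂
  have h₁' := h₁.unique (hasDerivAt_const x 0)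
  have h₂' := h₂.unique (hasDerivAt_const x 0)
  simp only [map_add, map_mul, map_neg, hμ, hρ, eval_add, eval_mul, eval_neg, ← hκ]
  exact ⟨by linear_combination ρ.eval (α j) * h₁', by linear_combination ρ.eval (α j) * h₂'⟩

theorem deriv_fst_eq (hN : 0 < N) (hα : Function.Injective (nodes α)) (hu : ∀ j, u x j ≠ 0)
    (h : IsDateFlow α (fun j => Complex.I / 2 * α j) u v f g f' g' x) :
    f' = C (Complex.I * (g x).coeff (N - 1)) * conjPoly (g x) ∧
      g' = C Complex.I * X * g x - C (Complex.I * (g x).coeff (N - 1)) * conjPoly (f x) := by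
  have hsol := h.isDateSolution x
  have hmem : (f', g' - C Complex.I * (X * g x)) ∈ dateModule α (u x) (v x) := by
    have hflow := h.deriv_mem_dateModule (μ := C (Complex.I / 2) * X) (ρ := 1)
      (by simp [neg_div, map_ofNat]) (map_one _) (by simp)
    convert sub_mem hflow (Submodule.smul_mem _ (C (Complex.I / 2) * X) hsol.mem) using 1
    have hI : C Complex.I = C (Complex.I / 2) + C (Complex.I / 2) := by rw [← C_add, add_halves]
    ext1
    · simp
    · rw [hI]
      simp only [Prod.snd_sub, Prod.smul_snd, smul_eq_mul]
      ring
  obtain ⟨hf', hg'⟩ := hsol.eq_combination hα hu hmem h.natDegree_fst_le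
    ((natDegree_sub_le_of_le h.natDegree_snd_le ((natDegree_C_mul_le _ _).trans
      (natDegree_X_mul_le_of_coeff_eq_zero hsol.natDegree_snd_le hsol.coeff_snd))).trans_eq
        (max_self N))
  have hcoeff : (X * g x).coeff N = (g x).coeff (N - 1) := by
    conv_lhs => rw [← Nat.sub_add_cancel hN, coeff_X_mul]
  simp only [h.coeff_fst, h.coeff_snd, coeff_sub, coeff_C_mul, hcoeff, zero_sub, map_neg, C_0,
    zero_mul] at hf' hg'
  exact ⟨by linear_combination hf', by linear_combination hg'⟩

theorem exists_deriv_snd_eq (hN : 0 < N) (hα : Function.Injective (nodes α))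
    (hu : ∀ j, u x j ≠ 0) (h : IsDateFlow α (fun j => Complex.I / 2 * (α j)⁻¹) u v f g f' g' x) :
    ∃ a : ℂ, C (Complex.I / 2) * f x + X * f' =
        C a * f x - C (g'.coeff (N - 1)) * conjPoly (g x) ∧
      C (-(Complex.I / 2)) * g x + X * g' = C a * g x + C (g'.coeff (N - 1)) * conjPoly (f x) := by
  have hsol := h.isDateSolution x
  have hα₀ (j : Fin N) : α j ≠ 0 := by simpa [nodes] using (ofReal_ne_nodes hα 0 (.inl j)).symm
  have hmem := h.deriv_mem_dateModule (μ := C (Complex.I / 2)) (ρ := X)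
    (by simp [neg_div, map_ofNat]) conjPoly_X
    fun j => by rw [eval_X, eval_C, mul_left_comm, mul_inv_cancel₀ (hα₀ j), mul_one]
  rw [← C_neg] at hmem
  obtain ⟨hf', hg'⟩ := hsol.eq_combination hα hu hmem
    (natDegree_add_le_of_degree_le ((natDegree_C_mul_le _ _).trans hsol.natDegree_fst_le)
      (natDegree_X_mul_le_of_coeff_eq_zero h.natDegree_fst_le h.coeff_fst))
    (natDegree_add_le_of_degree_le ((natDegree_C_mul_le _ _).trans hsol.natDegree_snd_le)
      (natDegree_X_mul_le_of_coeff_eq_zero h.natDegree_snd_le h.coeff_snd))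
  have hcoeff : (C (-(Complex.I / 2)) * g x + X * g').coeff N = g'.coeff (N - 1) := by
    rw [coeff_add, coeff_C_mul, hsol.coeff_snd, mul_zero, zero_add]
    conv_lhs => rw [← Nat.sub_add_cancel hN, coeff_X_mul]
  rw [hcoeff] at hf' hg'
  exact ⟨_, hf', hg'⟩

-- The constants are read off the constant coefficients, where `X f'` and `X g'` vanish.
theorem deriv_snd_eq (hN : 0 < N) (hα : Function.Injective (nodes α)) (hu : ∀ j, u x j ≠ 0)
    (h : IsDateFlow α (fun j => Complex.I / 2 * (α j)⁻¹) u v f g f' g' x) :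
    X * f' = C (Complex.I / 2 * (diagCoeff α (f x) (g x) - 1)) * f x +
        C (Complex.I * offDiagCoeff α (f x) (g x)) * conjPoly (g x) ∧
      X * g' = C (Complex.I / 2 * (diagCoeff α (f x) (g x) + 1)) * g x -
        C (Complex.I * offDiagCoeff α (f x) (g x)) * conjPoly (f x) ∧
      g'.coeff (N - 1) = -(Complex.I * offDiagCoeff α (f x) (g x)) := by
  obtain ⟨a, hf', hg'⟩ := h.exists_deriv_snd_eq hN hα hu
  have hΔ : (nodeNorm α 0 : ℂ) ≠ 0 := Complex.ofReal_ne_zero.2 (nodeNorm_pos hα 0).ne'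
  have hΔf := (h.isDateSolution x).norm_sq_coeff_zero hα hu
  have hf₀ := congrArg (coeff · 0) hf'
  have hg₀ := congrArg (coeff · 0) hg'
  simp only [coeff_add, coeff_sub, coeff_C_zero, mul_coeff_zero, coeff_X_zero, zero_mul, add_zero,
    coeff_conjPoly] at hf₀ hg₀
  have hΔf' : (f x).coeff 0 * conj ((f x).coeff 0) + (g x).coeff 0 * conj ((g x).coeff 0) =
      nodeNorm α 0 := by
    simp only [← hΔf, Complex.mul_conj', Complex.ofReal_add, Complex.ofReal_pow]
  have ha : a = Complex.I / 2 * diagCoeff α (f x) (g x) := by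
    simp only [diagCoeff, Complex.ofReal_div, Complex.ofReal_sub, Complex.ofReal_pow,
      ← Complex.mul_conj']
    rw [← mul_div_assoc, eq_div_iff hΔ, ← hΔf']
    linear_combination -conj ((f x).coeff 0) * hf₀ - conj ((g x).coeff 0) * hg₀
  have hb : g'.coeff (N - 1) = -(Complex.I * offDiagCoeff α (f x) (g x)) := by
    rw [offDiagCoeff, ← mul_div_assoc, ← neg_div, eq_div_iff hΔ, ← hΔf']
    linear_combination (g x).coeff 0 * hf₀ - (f x).coeff 0 * hg₀
  rw [ha, hb] at hf' hg'
  simp only [mul_sub, mul_add, mul_one, map_sub, map_add, map_neg] at hf' hg' ⊢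
  exact ⟨by linear_combination hf', by linear_combination hg', hb⟩

end IsDateFlow

end Flow

/-- Matrix-valued functions of `l` with the symmetry `M(l) = J (conj M(conj l)) J⁻¹` of the wave
function. -/
def IsQuaternionic (M : ℂ → Matrix (Fin 2) (Fin 2) ℂ) : Prop :=
  ∀ l, M l 0 1 = -conj (M (conj l) 1 0) ∧ M l 1 1 = conj (M (conj l) 0 0)

namespace IsQuaternionic

variable {A B : ℂ → Matrix (Fin 2) (Fin 2) ℂ}

theorem mul (hA : IsQuaternionic A) (hB : IsQuaternionic B) :
    IsQuaternionic fun l => A l * B l := fun l => by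
  obtain ⟨hA₀, hA₁⟩ := hA (conj l)
  obtain ⟨hA₂, hA₃⟩ := hA l
  obtain ⟨hB₀, hB₁⟩ := hB l
  simp only [Complex.conj_conj] at hA₀ hA₁
  simp only [Matrix.mul_apply, Fin.sum_univ_two, hA₀, hA₁, hA₂, hA₃, hB₀, hB₁, map_add, map_mul,
    map_neg, Complex.conj_conj]
  constructor <;> ring

theorem hasDerivAt {M : ℝ → ℂ → Matrix (Fin 2) (Fin 2) ℂ} {M' : ℂ → Matrix (Fin 2) (Fin 2) ℂ}
    (hM : ∀ x, IsQuaternionic (M x)) (hM' : IsQuaternionic M') {x : ℝ} {l : ℂ}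
    (h : ∀ i, HasDerivAt (fun y => M y l i 0) (M' l i 0) x)
    (hconj : ∀ i, HasDerivAt (fun y => M y (conj l) i 0) (M' (conj l) i 0) x) (i j : Fin 2) :
    HasDerivAt (fun y => M y l i j) (M' l i j) x := by
  fin_cases j
  · exact h i
  · fin_cases i
    · change HasDerivAt (fun y => M y l 0 1) (M' l 0 1) x
      simp only [(hM _ l).1, (hM' l).1]
      exact (hconj 1).star.fun_neg
    · change HasDerivAt (fun y => M y l 1 1) (M' l 1 1) x
      simp only [(hM _ l).2, (hM' l).2]
      exact (hconj 0).star

theorem det_ofReal (hA : IsQuaternionic A) (l : ℝ) :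
    (A l).det = ((‖A l 0 0‖ ^ 2 + ‖A l 1 0‖ ^ 2 : ℝ) : ℂ) := by
  obtain ⟨h₀, h₁⟩ := hA l
  rw [Complex.conj_ofReal] at h₀ h₁
  rw [Matrix.det_fin_two, h₀, h₁, neg_mul, sub_neg_eq_add, Complex.ofReal_add, Complex.ofReal_pow,
    Complex.ofReal_pow, Complex.mul_conj', Complex.conj_mul']

theorem inv_sqrt_smul_mem_specialUnitaryGroup (hA : IsQuaternionic A) (l : ℝ)
    (hpos : 0 < ‖A l 0 0‖ ^ 2 + ‖A l 1 0‖ ^ 2) :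
    (√(‖A l 0 0‖ ^ 2 + ‖A l 1 0‖ ^ 2) : ℂ)⁻¹ • A l ∈ Matrix.specialUnitaryGroup (Fin 2) ℂ := by
  set D := ‖A l 0 0‖ ^ 2 + ‖A l 1 0‖ ^ 2 with hD
  have hsq : (√D : ℂ)⁻¹ * (√D : ℂ)⁻¹ * D = 1 := by
    rw [← mul_inv, ← Complex.ofReal_mul, Real.mul_self_sqrt hpos.le, inv_mul_cancel₀]
    exact Complex.ofReal_ne_zero.2 hpos.ne'
  have hunit : A l * star (A l) = (D : ℂ) • 1 := by
    obtain ⟨h₀, h₁⟩ := hA l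
    rw [Complex.conj_ofReal] at h₀ h₁
    ext i j
    fin_cases i <;> fin_cases j <;>
      simp [Matrix.mul_apply, Fin.sum_univ_two, h₀, h₁, hD, ← Complex.mul_conj'] <;> ring
  rw [Matrix.mem_specialUnitaryGroup_iff, Matrix.mem_unitaryGroup_iff]
  constructor
  · rw [star_smul, Matrix.smul_mul, Matrix.mul_smul, hunit, smul_smul, smul_smul, star_inv₀,
      Complex.star_def, Complex.conj_ofReal, hsq, one_smul]
  · rw [Matrix.det_smul, Fintype.card_fin, sq, hA.det_ofReal, hsq]

end IsQuaternionic

/-! ### The Lax pair of the wave function -/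

section WaveFunction

variable {N : ℕ} {α c : Fin N → ℂ}

theorem contDiff_coeff_ofFn {v : ℝ × ℝ → Fin N → ℂ} (hv : ∀ j, ContDiff ℝ ∞ fun p => v p j)
    (n : ℕ) : ContDiff ℝ ∞ fun p => (ofFn N (v p)).coeff n := by
  rcases lt_or_ge n N with hn | hn
  · simpa only [ofFn_coeff_eq_val_of_lt _ hn] using hv ⟨n, hn⟩
  · simpa only [ofFn_coeff_eq_zero_of_ge _ hn] using contDiff_const

theorem contDiff_coeff_fPoly (hα : Function.Injective (nodes α)) (n : ℕ) :
    ContDiff ℝ ∞ fun p : ℝ × ℝ => (fPoly α c p.1 p.2).coeff n := by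
  simp only [fPoly, coeff_add]
  exact contDiff_const.add (contDiff_coeff_ofFn (fun j => contDiff_d_div_d_zero hα (j + 1)) n)

theorem contDiff_coeff_gPoly (hα : Function.Injective (nodes α)) (n : ℕ) :
    ContDiff ℝ ∞ fun p : ℝ × ℝ => (gPoly α c p.1 p.2).coeff n := by
  simp only [gPoly, coeff_neg]
  exact (contDiff_coeff_ofFn (fun j => contDiff_d_div_d_zero hα (N + j + 1)) n).neg

theorem exists_isDateFlow (hα : Function.Injective (nodes α)) {σ : ℝ → ℝ × ℝ} {x : ℝ}
    (hσ : ContDiff ℝ ∞ σ) {κ : Fin N → ℂ}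
    (hκ : ∀ j, HasDerivAt (fun y => expFun (σ y).1 (σ y).2 (α j))
      (κ j * expFun (σ x).1 (σ x).2 (α j)) x) :
    ∃ f' g', IsDateFlow α κ (fun y => weightFst α (σ y).1 (σ y).2)
      (fun y => weightSnd α c (σ y).1 (σ y).2) (fun y => fPoly α c (σ y).1 (σ y).2)
      (fun y => gPoly α c (σ y).1 (σ y).2) f' g' x := by
  have hsol y := isDateSolution (c := c) hα (σ y).1 (σ y).2
  obtain ⟨f', hf'⟩ := exists_hasCoeffDerivAt (x := x) (fun y => (hsol y).natDegree_fst_le)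
    fun m => ((contDiff_coeff_fPoly hα m).comp hσ).differentiable (by simp) x
  obtain ⟨g', hg'⟩ := exists_hasCoeffDerivAt (x := x) (fun y => (hsol y).natDegree_snd_le)
    fun m => ((contDiff_coeff_gPoly hα m).comp hσ).differentiable (by simp) x
  refine ⟨f', g', hsol, hκ, fun j => ?_, hf', hg'⟩
  have he := expFun_ne_zero (σ x).1 (σ x).2 (α j)
  refine (((hκ j).fun_inv he).const_mul (c j)).congr_deriv ?_
  rw [weightSnd]
  field_simp

theorem exists_isDateFlow_fst (hα : Function.Injective (nodes α)) (s t : ℝ) :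
    ∃ f' g', IsDateFlow α (fun j => Complex.I / 2 * α j) (fun x => weightFst α x t)
      (fun x => weightSnd α c x t) (fun x => fPoly α c x t) (fun x => gPoly α c x t) f' g' s :=
  exists_isDateFlow hα (contDiff_prodMk_left t) fun j => hasDerivAt_expFun_fst s t (α j)

theorem exists_isDateFlow_snd (hα : Function.Injective (nodes α)) (s t : ℝ) :
    ∃ f' g', IsDateFlow α (fun j => Complex.I / 2 * (α j)⁻¹) (weightFst α s)
      (weightSnd α c s) (fPoly α c s) (gPoly α c s) f' g' t :=
  exists_isDateFlow hα (contDiff_prodMk_right s) fun j => hasDerivAt_expFun_snd s t (α j)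

theorem hasDerivAt_eval_fst (hN : 0 < N) (hα : Function.Injective (nodes α)) (s t : ℝ) (l : ℂ) :
    HasDerivAt (fun x => (fPoly α c x t).eval l)
      (Complex.I * (gPoly α c s t).coeff (N - 1) * conj ((gPoly α c s t).eval (conj l))) s ∧
    HasDerivAt (fun x => (gPoly α c x t).eval l)
      (Complex.I * l * (gPoly α c s t).eval l -
        Complex.I * (gPoly α c s t).coeff (N - 1) * conj ((fPoly α c s t).eval (conj l))) s := by
  obtain ⟨f', g', h⟩ := exists_isDateFlow_fst (c := c) hα s t
  obtain ⟨hf', hg'⟩ :=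
    h.deriv_fst_eq (u := fun x => weightFst α x t) hN hα (weightFst_ne_zero s t)
  have hf := h.hasCoeffDerivAt_fst.eval (fun y => (h.isDateSolution y).natDegree_fst_le) l
  have hg := h.hasCoeffDerivAt_snd.eval (fun y => (h.isDateSolution y).natDegree_snd_le) l
  rw [hf'] at hf
  rw [hg'] at hg
  simp only [eval_sub, eval_mul, eval_C, eval_X, eval_conjPoly] at hf hg
  exact ⟨hf, hg⟩

theorem hasDerivAt_eval_snd (hN : 0 < N) (hα : Function.Injective (nodes α)) (s t : ℝ) {l : ℂ}
    (hl : l ≠ 0) :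
    HasDerivAt (fun y => (fPoly α c s y).eval l)
      (l⁻¹ * (Complex.I / 2 * (diagCoeff α (fPoly α c s t) (gPoly α c s t) - 1) *
          (fPoly α c s t).eval l +
        Complex.I * offDiagCoeff α (fPoly α c s t) (gPoly α c s t) *
          conj ((gPoly α c s t).eval (conj l)))) t ∧
    HasDerivAt (fun y => (gPoly α c s y).eval l)
      (l⁻¹ * (Complex.I / 2 * (diagCoeff α (fPoly α c s t) (gPoly α c s t) + 1) *
          (gPoly α c s t).eval l -
        Complex.I * offDiagCoeff α (fPoly α c s t) (gPoly α c s t) *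
          conj ((fPoly α c s t).eval (conj l)))) t := by
  obtain ⟨f', g', h⟩ := exists_isDateFlow_snd (c := c) hα s t
  obtain ⟨hf', hg', -⟩ := h.deriv_snd_eq hN hα (weightFst_ne_zero s t)
  have hf := h.hasCoeffDerivAt_fst.eval (fun y => (h.isDateSolution y).natDegree_fst_le) l
  have hg := h.hasCoeffDerivAt_snd.eval (fun y => (h.isDateSolution y).natDegree_snd_le) l
  replace hf' := congrArg (Polynomial.eval l) hf'
  replace hg' := congrArg (Polynomial.eval l) hg'
  simp only [eval_add, eval_sub, eval_mul, eval_C, eval_X, eval_conjPoly] at hf' hg'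
  rw [← hf', ← hg', inv_mul_cancel_left₀ hl, inv_mul_cancel_left₀ hl]
  exact ⟨hf, hg⟩

theorem hasDerivAt_coeff_gPoly_snd (hN : 0 < N) (hα : Function.Injective (nodes α)) (s t : ℝ) :
    HasDerivAt (fun y => (gPoly α c s y).coeff (N - 1))
      (-(Complex.I * offDiagCoeff α (fPoly α c s t) (gPoly α c s t))) t := by
  obtain ⟨f', g', h⟩ := exists_isDateFlow_snd (c := c) hα s t
  rw [← (h.deriv_snd_eq hN hα (weightFst_ne_zero s t)).2.2]
  exact h.hasCoeffDerivAt_snd (N - 1)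

theorem coeff_gPoly_pred (hN : 0 < N) (s t : ℝ) :
    (gPoly α c s t).coeff (N - 1) = -(d α c (2 * N) s t / d α c 0 s t) := by
  rw [coeff_gPoly s t (Nat.sub_lt hN one_pos)]
  congr 3
  omega

theorem solitonSolution_eq (hN : 0 < N) (s t : ℝ) :
    solitonSolution α c s t = -(2 * Complex.I * conj ((gPoly α c s t).coeff (N - 1))) := by
  rw [solitonSolution, coeff_gPoly_pred hN, map_neg, mul_neg, neg_neg]

theorem hasDerivAt_solitonSolution_snd (hN : 0 < N) (hα : Function.Injective (nodes α))
    (s t : ℝ) : HasDerivAt (solitonSolution α c s)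
      (2 * conj (offDiagCoeff α (fPoly α c s t) (gPoly α c s t))) t := by
  rw [funext (solitonSolution_eq hN s)]
  refine ((hasDerivAt_coeff_gPoly_snd hN hα s t).star.const_mul (2 * Complex.I)).fun_neg.congr_deriv
    ?_
  simp only [Complex.star_def, map_neg, map_mul, Complex.conj_I]
  linear_combination -2 * conj (offDiagCoeff α (fPoly α c s t) (gPoly α c s t)) * Complex.I_mul_I

theorem dateL_eq_laxL (s t l : ℝ) :
    dateL α c s t l = laxL (solitonSolution α c) l s t := by
  rw [dateL, laxL, solitonSolution]
  congr 3
  simp [map_ofNat]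

variable (α c) in
/-- The antiderivative `h` of `∂ₜ|q|²` that belongs to the soliton solution `q`. -/
noncomputable def solitonPotential (s t : ℝ) : ℝ :=
  2 * diagCoeff α (fPoly α c s t) (gPoly α c s t)

theorem dateM_eq (hN : 0 < N) (hα : Function.Injective (nodes α)) (s t : ℝ) (l : ℂ) :
    dateM α c s t l = (Complex.I / (2 * l)) •
      !![(diagCoeff α (fPoly α c s t) (gPoly α c s t) : ℂ),
        -(2 * conj (offDiagCoeff α (fPoly α c s t) (gPoly α c s t)));
        -(2 * offDiagCoeff α (fPoly α c s t) (gPoly α c s t)),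
        -(diagCoeff α (fPoly α c s t) (gPoly α c s t) : ℂ)] := by
  have hd := d_zero_ne_zero (c := c) hα s t
  obtain ⟨r, hr⟩ := Complex.conj_eq_iff_real.1 (conj_d_zero (α := α) (c := c) s t)
  have hd₁ : d α c 1 s t = (fPoly α c s t).coeff 0 * r := by
    rw [coeff_fPoly s t hN, ← hr, div_mul_cancel₀ _ hd]
  have hdN : d α c (N + 1) s t = -((gPoly α c s t).coeff 0 * r) := by
    rw [coeff_gPoly s t hN, ← hr, neg_mul, neg_neg, div_mul_cancel₀ _ hd]
  have hr₀ : (r : ℂ) ≠ 0 := hr ▸ hd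
  have hΔ : (nodeNorm α 0 : ℂ) ≠ 0 := Complex.ofReal_ne_zero.2 (nodeNorm_pos hα 0).ne'
  have hnorm (z : ℂ) : ‖z * (r : ℂ)‖ ^ 2 = r ^ 2 * ‖z‖ ^ 2 := by
    rw [norm_mul, mul_pow, Complex.norm_real, Real.norm_eq_abs, sq_abs, mul_comm]
  have hsum : ‖d α c 1 s t‖ ^ 2 + ‖d α c (N + 1) s t‖ ^ 2 = r ^ 2 * nodeNorm α 0 := by
    rw [hd₁, hdN, norm_neg, hnorm, hnorm, ← mul_add,
      (isDateSolution hα s t).norm_sq_coeff_zero hα (weightFst_ne_zero s t)]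
  have hdiff : ‖d α c 1 s t‖ ^ 2 - ‖d α c (N + 1) s t‖ ^ 2 =
      r ^ 2 * (‖(fPoly α c s t).coeff 0‖ ^ 2 - ‖(gPoly α c s t).coeff 0‖ ^ 2) := by
    rw [hd₁, hdN, norm_neg, hnorm, hnorm, ← mul_sub]
  rw [dateM, neg_add_eq_sub, ← neg_sub (‖d α c 1 s t‖ ^ 2), hsum, hdiff, hd₁, hdN, diagCoeff,
    offDiagCoeff]
  rcases eq_or_ne l 0 with rfl | hl
  · simp
  ext i j
  fin_cases i <;> fin_cases j <;> simp [Complex.conj_ofReal] <;> field_simp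

theorem dateM_eq_laxM (hN : 0 < N) (hα : Function.Injective (nodes α)) (s t l : ℝ) :
    dateM α c s t l = laxM (solitonSolution α c) (solitonPotential α c) l s t := by
  rw [dateM_eq hN hα, laxM, (hasDerivAt_solitonSolution_snd hN hα s t).deriv, solitonPotential]
  congr 3 <;> simp [map_ofNat]

theorem Psi_zero_zero (s t : ℝ) (l : ℂ) :
    Psi α c s t l 0 0 = (fPoly α c s t).eval l * expFun s t l := by
  rw [eval_fPoly]
  rfl

theorem Psi_one_zero (s t : ℝ) (l : ℂ) :
    Psi α c s t l 1 0 = (gPoly α c s t).eval l * (expFun s t l)⁻¹ := by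
  rw [eval_gPoly, expFun, ← Complex.exp_neg]
  rfl

theorem isQuaternionic_Psi (s t : ℝ) : IsQuaternionic (Psi α c s t) := fun _ => ⟨rfl, rfl⟩

theorem isQuaternionic_dateL (s t : ℝ) : IsQuaternionic (dateL α c s t) := fun l => by
  constructor <;> simp [dateL, map_ofNat]

theorem isQuaternionic_dateM (s t : ℝ) : IsQuaternionic (dateM α c s t) := fun l => by
  constructor <;>
    simp only [dateM, Matrix.smul_apply, Matrix.of_apply, Matrix.cons_val', Matrix.cons_val_zero,
      Matrix.cons_val_one, Matrix.cons_val_fin_one, smul_eq_mul, map_mul, map_div₀, map_ofNat,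
      Complex.conj_I, Complex.conj_conj, Complex.conj_ofReal] <;>
    push_cast <;> ring

theorem hasDerivAt_Psi_fst (hN : 0 < N) (hα : Function.Injective (nodes α)) (s t : ℝ) (l : ℂ)
    (i : Fin 2) :
    HasDerivAt (fun x => Psi α c x t l i 0) ((Psi α c s t l * dateL α c s t l) i 0) s := by
  obtain ⟨hf, hg⟩ := hasDerivAt_eval_fst (c := c) hN hα s t l
  obtain ⟨hΨ₀, hΨ₁⟩ := isQuaternionic_Psi (α := α) (c := c) s t l
  have he := hasDerivAt_expFun_fst s t l
  have he₀ := expFun_ne_zero s t l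
  rw [Matrix.mul_apply, Fin.sum_univ_two]
  fin_cases i
  · simp only [Fin.zero_eta, hΨ₀, Psi_zero_zero, Psi_one_zero]
    refine (hf.fun_mul he).congr_deriv ?_
    simp only [dateL, coeff_gPoly_pred hN, conj_expFun, Complex.conj_conj, map_inv₀, inv_inv,
      Matrix.smul_apply, Matrix.of_apply, Matrix.cons_val', Matrix.cons_val_zero,
      Matrix.cons_val_one, Matrix.cons_val_fin_one, smul_eq_mul,
      map_mul, map_div₀]
    ring
  · simp only [Fin.mk_one, hΨ₁, Psi_zero_zero, Psi_one_zero]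
    refine (hg.fun_mul (he.fun_inv he₀)).congr_deriv ?_
    simp only [dateL, coeff_gPoly_pred hN, conj_expFun, Complex.conj_conj,
      Matrix.smul_apply, Matrix.of_apply, Matrix.cons_val', Matrix.cons_val_zero,
      Matrix.cons_val_one, Matrix.cons_val_fin_one, smul_eq_mul, map_mul, map_div₀]
    field_simp
    ring

theorem hasDerivAt_Psi_snd (hN : 0 < N) (hα : Function.Injective (nodes α)) (s t : ℝ) {l : ℂ}
    (hl : l ≠ 0) (i : Fin 2) :
    HasDerivAt (fun y => Psi α c s y l i 0) ((Psi α c s t l * dateM α c s t l) i 0) t := by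
  obtain ⟨hf, hg⟩ := hasDerivAt_eval_snd (c := c) hN hα s t hl
  obtain ⟨hΨ₀, hΨ₁⟩ := isQuaternionic_Psi (α := α) (c := c) s t l
  have he := hasDerivAt_expFun_snd s t l
  have he₀ := expFun_ne_zero s t l
  rw [Matrix.mul_apply, Fin.sum_univ_two, dateM_eq hN hα]
  fin_cases i
  · simp only [Fin.zero_eta, hΨ₀, Psi_zero_zero, Psi_one_zero]
    refine (hf.fun_mul he).congr_deriv ?_
    simp only [conj_expFun, Complex.conj_conj, map_inv₀, inv_inv,
      Matrix.smul_apply, Matrix.of_apply, Matrix.cons_val', Matrix.cons_val_zero,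
      Matrix.cons_val_one, Matrix.cons_val_fin_one, smul_eq_mul, map_mul]
    field_simp
    ring
  · simp only [Fin.mk_one, hΨ₁, Psi_zero_zero, Psi_one_zero]
    refine (hg.fun_mul (he.fun_inv he₀)).congr_deriv ?_
    simp only [conj_expFun, Complex.conj_conj,
      Matrix.smul_apply, Matrix.of_apply, Matrix.cons_val', Matrix.cons_val_zero,
      Matrix.cons_val_one, Matrix.cons_val_fin_one, smul_eq_mul, map_mul]
    field_simp
    ring

theorem Psi_solvesLaxPair (hN : 0 < N) (hα : Function.Injective (nodes α)) {l : ℂ} (hl : l ≠ 0) :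
    SolvesLaxPair (fun s t => Psi α c s t l) (fun s t => dateL α c s t l)
      (fun s t => dateM α c s t l) := fun s t i j =>
  have hl' : conj l ≠ 0 := (_root_.map_ne_zero _).2 hl
  ⟨IsQuaternionic.hasDerivAt (fun x => isQuaternionic_Psi x t)
      ((isQuaternionic_Psi s t).mul (isQuaternionic_dateL s t))
      (hasDerivAt_Psi_fst hN hα s t l) (hasDerivAt_Psi_fst hN hα s t (conj l)) i j,
    IsQuaternionic.hasDerivAt (isQuaternionic_Psi s)
      ((isQuaternionic_Psi s t).mul (isQuaternionic_dateM s t))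
      (hasDerivAt_Psi_snd hN hα s t hl) (hasDerivAt_Psi_snd hN hα s t hl') i j⟩

theorem vecMul_Psi (hα : Function.Injective (nodes α)) (s t : ℝ) (j : Fin N) :
    Matrix.vecMul ![1, c j] (Psi α c s t (α j)) = 0 := by
  obtain ⟨h₀, h₁⟩ := mem_dateModule.1 (isDateSolution (c := c) hα s t).mem j
  obtain ⟨hΨ₀, hΨ₁⟩ := isQuaternionic_Psi (α := α) (c := c) s t (α j)
  simp only [weightFst, weightSnd, eval_conjPoly] at h₀ h₁
  ext i
  fin_cases i <;>
    simp [Matrix.vecMul, dotProduct, hΨ₀, hΨ₁, Psi_zero_zero, Psi_one_zero, conj_expFun]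
  · linear_combination h₀
  · linear_combination h₁

theorem f_eq (s t : ℝ) (l : ℂ) : f α c s t l = (fPoly α c s t).eval l := by
  rw [f, Psi_zero_zero, expFun_neg, mul_inv_cancel_right₀ (expFun_ne_zero s t l)]

theorem g_eq (s t : ℝ) (l : ℂ) : g α c s t l = (gPoly α c s t).eval l := by
  rw [g, Psi_one_zero, inv_mul_cancel_right₀ (expFun_ne_zero s t l)]

/-! ### The Pohlmeyer-Lund-Regge equation -/

theorem hasDerivAt_coeff_zero_fst (hN : 0 < N) (hα : Function.Injective (nodes α)) (s t : ℝ) :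
    HasDerivAt (fun x => (fPoly α c x t).coeff 0)
      (Complex.I * (gPoly α c s t).coeff (N - 1) * conj ((gPoly α c s t).coeff 0)) s ∧
    HasDerivAt (fun x => (gPoly α c x t).coeff 0)
      (-(Complex.I * (gPoly α c s t).coeff (N - 1) * conj ((fPoly α c s t).coeff 0))) s := by
  simpa only [coeff_zero_eq_eval_zero, map_zero, mul_zero, zero_mul, zero_sub] using
    hasDerivAt_eval_fst (c := c) hN hα s t 0

theorem hasDerivAt_diagCoeff_fst (hN : 0 < N) (hα : Function.Injective (nodes α)) (s t : ℝ) :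
    HasDerivAt (fun x => diagCoeff α (fPoly α c x t) (gPoly α c x t))
      (4 * (Complex.I * (gPoly α c s t).coeff (N - 1) *
        conj (offDiagCoeff α (fPoly α c s t) (gPoly α c s t))).re) s := by
  obtain ⟨hf, hg⟩ := hasDerivAt_coeff_zero_fst (c := c) hN hα s t
  refine ((hf.norm_sq.fun_sub hg.norm_sq).div_const _).congr_deriv ?_
  rw [offDiagCoeff, map_div₀, Complex.conj_ofReal, ← mul_div_assoc, Complex.div_ofReal_re]
  simp only [Complex.inner, map_mul, Complex.mul_re, Complex.mul_im, Complex.conj_re,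
    Complex.conj_im, Complex.I_re, Complex.I_im, Complex.neg_re, Complex.neg_im]
  ring

theorem hasDerivAt_offDiagCoeff_fst (hN : 0 < N) (hα : Function.Injective (nodes α)) (s t : ℝ) :
    HasDerivAt (fun x => offDiagCoeff α (fPoly α c x t) (gPoly α c x t))
      (-(Complex.I * (gPoly α c s t).coeff (N - 1) *
        diagCoeff α (fPoly α c s t) (gPoly α c s t))) s := by
  obtain ⟨hf, hg⟩ := hasDerivAt_coeff_zero_fst (c := c) hN hα s t
  refine ((hf.fun_mul hg).div_const _).congr_deriv ?_
  rw [diagCoeff, Complex.ofReal_div, Complex.ofReal_sub, Complex.ofReal_pow, Complex.ofReal_pow,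
    ← Complex.mul_conj', ← Complex.mul_conj']
  ring

theorem contDiff_solitonSolution (hα : Function.Injective (nodes α)) :
    ContDiff ℝ ∞ fun p : ℝ × ℝ => solitonSolution α c p.1 p.2 :=
  contDiff_const.mul (Complex.conjCLE.contDiff.comp (contDiff_d_div_d_zero hα _))

theorem isPLRSolution (hN : 0 < N) (hα : Function.Injective (nodes α)) :
    IsPLRSolution (solitonSolution α c) (solitonPotential α c) := by
  refine ⟨contDiff_solitonSolution hα, fun s t => ?_, fun s t => ?_⟩
  · refine ((hasDerivAt_diagCoeff_fst hN hα s t).const_mul 2).congr_deriv ?_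
    rw [(hasDerivAt_solitonSolution_snd hN hα s t).norm_sq.deriv, solitonSolution_eq hN]
    simp only [Complex.inner, map_mul, map_neg, Complex.mul_re, Complex.mul_im, Complex.conj_re,
      Complex.conj_im, Complex.I_re, Complex.I_im, Complex.neg_re, Complex.neg_im,
      Complex.re_ofNat, Complex.im_ofNat]
    ring
  · have hq x : deriv (fun y => solitonSolution α c x y) t = _ :=
      (hasDerivAt_solitonSolution_snd hN hα x t).deriv
    have hq' := ((hasDerivAt_offDiagCoeff_fst (c := c) hN hα s t).star.const_mul 2).deriv
    simp only [Complex.star_def] at hq'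
    simp only [hq]
    rw [hq', solitonSolution_eq hN, solitonPotential]
    simp only [map_neg, map_mul, Complex.conj_I, Complex.conj_ofReal, Complex.ofReal_mul,
      Complex.ofReal_ofNat]
    ring

end WaveFunction

/-! ### The Sym formula -/

section Entrywise

variable {m n p : Type*}

/-- Derivative of a curve of matrices. It is taken entry by entry because matrices carry no
canonical norm. -/
def HasEntrywiseDerivAt (A : ℝ → Matrix m n ℂ) (A' : Matrix m n ℂ) (x : ℝ) : Prop :=
  ∀ i j, HasDerivAt (fun y => A y i j) (A' i j) x

/-- The entry by entry derivative of a curve of matrices, with the junk values of `deriv`. -/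
noncomputable def entrywiseDeriv (A : ℝ → Matrix m n ℂ) (x : ℝ) : Matrix m n ℂ :=
  Matrix.of fun i j => deriv (fun y => A y i j) x

namespace HasEntrywiseDerivAt

variable {A : ℝ → Matrix m n ℂ} {A' : Matrix m n ℂ} {B : ℝ → Matrix n p ℂ} {B' : Matrix n p ℂ}
  {x : ℝ}

theorem mul [Fintype n] (hA : HasEntrywiseDerivAt A A' x) (hB : HasEntrywiseDerivAt B B' x) :
    HasEntrywiseDerivAt (fun y => A y * B y) (A' * B x + A x * B') x := fun i j => by
  simp only [Matrix.mul_apply, Matrix.add_apply, ← Finset.sum_add_distrib]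
  exact HasDerivAt.fun_sum fun k _ => (hA i k).fun_mul (hB k j)

theorem mul_const [Fintype n] (hA : HasEntrywiseDerivAt A A' x) (B : Matrix n p ℂ) :
    HasEntrywiseDerivAt (fun y => A y * B) (A' * B) x := fun i j => by
  simp only [Matrix.mul_apply]
  exact HasDerivAt.fun_sum fun k _ => (hA i k).mul_const _

theorem smul {r : ℝ → ℂ} {r' : ℂ} (hr : HasDerivAt r r' x) (hA : HasEntrywiseDerivAt A A' x) :
    HasEntrywiseDerivAt (fun y => r y • A y) (r' • A x + r x • A') x := fun i j =>
  hr.fun_mul (hA i j)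

theorem conjTranspose (hA : HasEntrywiseDerivAt A A' x) :
    HasEntrywiseDerivAt (fun y => (A y)ᴴ) A'ᴴ x := fun i j => (hA j i).star

theorem entrywiseDeriv_eq (hA : HasEntrywiseDerivAt A A' x) : entrywiseDeriv A x = A' := by
  ext i j
  exact (hA i j).deriv

theorem congr_deriv (hA : HasEntrywiseDerivAt A A' x) {A'' : Matrix m n ℂ} (h : A' = A'') :
    HasEntrywiseDerivAt A A'' x := h ▸ hA

theorem mul_mul_conjTranspose [Fintype n] {A : ℝ → Matrix n n ℂ} {M : Matrix n n ℂ}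
    (hA : HasEntrywiseDerivAt A (A x * M) x) (hM : Mᴴ = -M) (B : Matrix n n ℂ) :
    HasEntrywiseDerivAt (fun y => A y * B * (A y)ᴴ) (A x * (M * B - B * M) * (A x)ᴴ) x := by
  refine ((hA.mul_const B).mul hA.conjTranspose).congr_deriv ?_
  rw [Matrix.conjTranspose_mul, hM]
  noncomm_ring

end HasEntrywiseDerivAt

theorem hasDerivAt_deriv_of_contDiffAt {E : Type*} [NormedAddCommGroup E] [NormedSpace ℝ E]
    {Φ : ℝ → ℝ → E} {x l : ℝ} (hΦ : ContDiffAt ℝ 2 (fun p : ℝ × ℝ => Φ p.1 p.2) (x, l))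
    {H : ℝ → E} {H' : E} (hH : ∀ᶠ k in 𝓝 l, HasDerivAt (fun y => Φ y k) (H k) x)
    (hH' : HasDerivAt H H' l) : HasDerivAt (fun y => deriv (Φ y) l) H' x := by
  set Ψ : ℝ × ℝ → E := fun p => Φ p.1 p.2
  have hdiff : ∀ᶠ p in 𝓝 (x, l), DifferentiableAt ℝ Ψ p :=
    (hΦ.eventually (by simp)).mono fun p hp => hp.differentiableAt (by simp)
  have hfst : ContinuousAt (fun y : ℝ => (y, l)) x := by fun_prop
  have hsnd : ContinuousAt (fun k : ℝ => (x, k)) l := by fun_prop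
  have hcurve₁ (k : ℝ) : HasDerivAt (fun y => (y, k)) ((1 : ℝ), (0 : ℝ)) x :=
    (hasDerivAt_id x).prodMk (hasDerivAt_const x k)
  have hcurve₂ (y : ℝ) : HasDerivAt (fun k => (y, k)) ((0 : ℝ), (1 : ℝ)) l :=
    (hasDerivAt_const l y).prodMk (hasDerivAt_id l)
  have hD : HasFDerivAt (fderiv ℝ Ψ) (fderiv ℝ (fderiv ℝ Ψ) (x, l)) (x, l) :=
    ((hΦ.fderiv_right (m := 1) (by norm_cast)).differentiableAt (by simp)).hasFDerivAt
  have hH₁ : H =ᶠ[𝓝 l] fun k => fderiv ℝ Ψ (x, k) (1, 0) := by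
    filter_upwards [hH, hsnd.eventually hdiff] with k hk hk'
    exact hk.unique (hk'.hasFDerivAt.comp_hasDerivAt (f := fun y => (y, k)) x (hcurve₁ k))
  have hderiv : (fun y => deriv (Φ y) l) =ᶠ[𝓝 x] fun y => fderiv ℝ Ψ (y, l) (0, 1) := by
    filter_upwards [hfst.eventually hdiff] with y hy
    exact (hy.hasFDerivAt.comp_hasDerivAt (f := fun k => (y, k)) l (hcurve₂ y)).deriv
  have h₁ := ((hD.comp_hasDerivAt (f := fun k => (x, k)) l (hcurve₂ x)).clm_apply
    (hasDerivAt_const l ((1 : ℝ), (0 : ℝ)))).congr_of_eventuallyEq hH₁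
  have h₂ := ((hD.comp_hasDerivAt (f := fun y => (y, l)) x (hcurve₁ l)).clm_apply
    (hasDerivAt_const x ((0 : ℝ), (1 : ℝ)))).congr_of_eventuallyEq hderiv
  simp only [map_zero, add_zero] at h₁ h₂
  rwa [hH'.unique h₁, (hΦ.isSymmSndFDerivAt (by simp)).eq]

theorem hasEntrywiseDerivAt_entrywiseDeriv_mul_conjTranspose [Fintype n]
    {G : ℝ → ℝ → Matrix n n ℂ} {A : ℝ → Matrix n n ℂ} {A' : Matrix n n ℂ} {x l : ℝ}
    (hG : ∀ i j, ContDiffAt ℝ 2 (fun p : ℝ × ℝ => G p.1 p.2 i j) (x, l))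
    (hGA : ∀ᶠ k in 𝓝 l, HasEntrywiseDerivAt (fun y => G y k) (G x k * A k) x)
    (hA : HasEntrywiseDerivAt A A' l) (hskew : (A l)ᴴ = -A l) :
    HasEntrywiseDerivAt (fun y => entrywiseDeriv (G y) l * (G y l)ᴴ)
      (G x l * A' * (G x l)ᴴ) x := by
  have hGl : HasEntrywiseDerivAt (G x) (entrywiseDeriv (G x) l) l := fun i j =>
    (((hG i j).differentiableAt (by simp)).comp l (f := fun k : ℝ => (x, k))
      (by fun_prop)).hasDerivAt
  have hmixed : HasEntrywiseDerivAt (fun y => entrywiseDeriv (G y) l)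
      (entrywiseDeriv (G x) l * A l + G x l * A') x := fun i j =>
    hasDerivAt_deriv_of_contDiffAt (Φ := fun y k => G y k i j) (hG i j)
      (hGA.mono fun k hk => hk i j) (hGl.mul hA i j)
  refine (hmixed.mul hGA.self_of_nhds.conjTranspose).congr_deriv ?_
  rw [Matrix.conjTranspose_mul, hskew]
  noncomm_ring

end Entrywise

section Su2

/-- Membership in the Lie algebra `𝔰𝔲(2)` of traceless skew-Hermitian matrices. -/
def IsSu2 (A : Matrix (Fin 2) (Fin 2) ℂ) : Prop := Aᴴ = -A ∧ A.trace = 0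

theorem isSu2_su2OfR3 (v : Fin 3 → ℝ) : IsSu2 (su2OfR3 v) := by
  refine ⟨?_, by simp [su2OfR3, Matrix.trace_fin_two]⟩
  ext i j
  fin_cases i <;> fin_cases j <;> simp [su2OfR3, Matrix.conjTranspose_apply] <;> ring

theorem isSu2_laxL (q : ℝ → ℝ → ℂ) (l s t : ℝ) : IsSu2 (laxL q l s t) := by
  refine ⟨?_, by simp [laxL, Matrix.trace_fin_two]⟩
  ext i j
  fin_cases i <;> fin_cases j <;> simp [laxL, Matrix.conjTranspose_apply]

theorem isSu2_laxM (q : ℝ → ℝ → ℂ) (h : ℝ → ℝ → ℝ) (l s t : ℝ) : IsSu2 (laxM q h l s t) := by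
  refine ⟨?_, by simp [laxM, Matrix.trace_fin_two]⟩
  ext i j
  fin_cases i <;> fin_cases j <;>
    simp [laxM, Matrix.conjTranspose_apply, Complex.conj_ofReal] <;> ring

theorem det_su2OfR3 (v : Fin 3 → ℝ) :
    (su2OfR3 v).det = ((‖WithLp.toLp 2 v‖ ^ 2 / 4 : ℝ) : ℂ) := by
  rw [EuclideanSpace.norm_sq_eq, Fin.sum_univ_three, su2OfR3, Matrix.det_smul,
    Matrix.det_fin_two_of]
  simp only [Real.norm_eq_abs, sq_abs, Fintype.card_fin]
  push_cast
  linear_combination (-((v 2 : ℂ) ^ 2 + (v 1 : ℂ) ^ 2) / 4) * Complex.I_sq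

theorem r3OfSu2_commutator_su2OfR3 (v w : Fin 3 → ℝ) :
    r3OfSu2 (su2OfR3 v * su2OfR3 w - su2OfR3 w * su2OfR3 v) = crossProduct v w := by
  ext i
  fin_cases i <;> simp [su2OfR3, r3OfSu2, cross_apply] <;> ring

namespace IsSu2

variable {A B U : Matrix (Fin 2) (Fin 2) ℂ}

theorem neg (hA : IsSu2 A) : IsSu2 (-A) :=
  ⟨by rw [Matrix.conjTranspose_neg, hA.1], by rw [Matrix.trace_neg, hA.2, neg_zero]⟩

theorem mul_mul_conjTranspose (hA : IsSu2 A) (hU : U ∈ Matrix.unitaryGroup (Fin 2) ℂ) :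
    IsSu2 (U * A * Uᴴ) := by
  have hU' : Uᴴ * U = 1 := Matrix.mem_unitaryGroup_iff'.1 hU
  constructor
  · rw [Matrix.conjTranspose_mul, Matrix.conjTranspose_mul, Matrix.conjTranspose_conjTranspose,
      hA.1]
    noncomm_ring
  · rw [Matrix.trace_mul_comm, ← Matrix.mul_assoc, hU', Matrix.one_mul, hA.2]

theorem su2OfR3_r3OfSu2 (hA : IsSu2 A) : su2OfR3 (r3OfSu2 A) = A := by
  obtain ⟨hskew, htrace⟩ := hA
  have h₀₀ : (A 0 0).re = 0 := by
    have := congrArg Complex.re (congrFun (congrFun hskew 0) 0)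
    simp only [Matrix.conjTranspose_apply, Matrix.neg_apply, Complex.star_def, Complex.conj_re,
      Complex.neg_re] at this
    linarith
  have h₀₁ : A 0 1 = -starRingEnd ℂ (A 1 0) := by
    rw [← Complex.star_def, ← Matrix.conjTranspose_apply, hskew, Matrix.neg_apply, neg_neg]
  have h₁₁ : A 1 1 = -A 0 0 := by
    rw [Matrix.trace_fin_two] at htrace
    linear_combination htrace
  ext i j
  fin_cases i <;> fin_cases j <;> apply Complex.ext <;>
    simp [su2OfR3, r3OfSu2, h₀₀, h₀₁, h₁₁]

theorem r3OfSu2_commutator (hA : IsSu2 A) (hB : IsSu2 B) :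
    r3OfSu2 (A * B - B * A) = crossProduct (r3OfSu2 A) (r3OfSu2 B) := by
  rw [← r3OfSu2_commutator_su2OfR3, hA.su2OfR3_r3OfSu2, hB.su2OfR3_r3OfSu2]

theorem det_eq (hA : IsSu2 A) : A.det = ((‖WithLp.toLp 2 (r3OfSu2 A)‖ ^ 2 / 4 : ℝ) : ℂ) := by
  rw [← det_su2OfR3, hA.su2OfR3_r3OfSu2]

theorem norm_r3OfSu2_mul_mul_conjTranspose (hA : IsSu2 A)
    (hU : U ∈ Matrix.unitaryGroup (Fin 2) ℂ) :
    ‖WithLp.toLp 2 (r3OfSu2 (U * A * Uᴴ))‖ = ‖WithLp.toLp 2 (r3OfSu2 A)‖ := by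
  have hU' : Uᴴ * U = 1 := Matrix.mem_unitaryGroup_iff'.1 hU
  have hdet : (U * A * Uᴴ).det = A.det := by
    rw [Matrix.det_mul_comm, ← Matrix.mul_assoc, hU', Matrix.one_mul]
  rw [(hA.mul_mul_conjTranspose hU).det_eq, hA.det_eq, Complex.ofReal_inj] at hdet
  exact (pow_left_inj₀ (norm_nonneg _) (norm_nonneg _) two_ne_zero).1 (by linarith)

end IsSu2

theorem commutator_conj {n : Type*} [Fintype n] [DecidableEq n] {U : Matrix n n ℂ}
    (hU : U ∈ Matrix.unitaryGroup n ℂ) (A B : Matrix n n ℂ) :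
    U * A * Uᴴ * (U * B * Uᴴ) - U * B * Uᴴ * (U * A * Uᴴ) = U * (A * B - B * A) * Uᴴ := by
  have hU' : Uᴴ * U = 1 := Matrix.mem_unitaryGroup_iff'.1 hU
  have hmul (C D : Matrix n n ℂ) : U * C * Uᴴ * (U * D * Uᴴ) = U * (C * D) * Uᴴ := by
    calc U * C * Uᴴ * (U * D * Uᴴ) = U * C * (Uᴴ * U) * D * Uᴴ := by noncomm_ring
      _ = U * (C * D) * Uᴴ := by rw [hU']; noncomm_ring
  rw [hmul, hmul]
  noncomm_ring

theorem HasEntrywiseDerivAt.r3OfSu2 {A : ℝ → Matrix (Fin 2) (Fin 2) ℂ}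
    {A' : Matrix (Fin 2) (Fin 2) ℂ} {x : ℝ} (hA : HasEntrywiseDerivAt A A' x) :
    HasDerivAt (fun y => r3OfSu2 (A y)) (r3OfSu2 A') x := by
  have hre i j := Complex.reCLM.hasFDerivAt.comp_hasDerivAt x (hA i j)
  have him i j := Complex.imCLM.hasFDerivAt.comp_hasDerivAt x (hA i j)
  refine hasDerivAt_pi.2 fun i => ?_
  fin_cases i
  exacts [(hre 1 0).const_mul 2, (him 1 0).const_mul (-2), (him 0 0).const_mul 2]

theorem contDiff_r3OfSu2 {E : Type*} [NormedAddCommGroup E] [NormedSpace ℝ E]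
    {A : E → Matrix (Fin 2) (Fin 2) ℂ} {n : WithTop ℕ∞}
    (hA : ∀ i j, ContDiff ℝ n fun y => A y i j) : ContDiff ℝ n fun y => r3OfSu2 (A y) := by
  have hre i j := Complex.reCLM.contDiff.comp (hA i j)
  have him i j := Complex.imCLM.contDiff.comp (hA i j)
  refine contDiff_pi.2 fun i => ?_
  fin_cases i
  exacts [contDiff_const.mul (hre 1 0), contDiff_const.mul (him 1 0),
    contDiff_const.mul (him 0 0)]

theorem isSu2_mul_conjTranspose {U : ℝ → Matrix (Fin 2) (Fin 2) ℂ}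
    {U' : Matrix (Fin 2) (Fin 2) ℂ} {x : ℝ}
    (hU : ∀ᶠ y in 𝓝 x, U y ∈ Matrix.specialUnitaryGroup (Fin 2) ℂ)
    (hU' : HasEntrywiseDerivAt U U' x) : IsSu2 (U' * (U x)ᴴ) := by
  have hunitary : U' * (U x)ᴴ + U x * U'ᴴ = 0 := by
    ext i j
    refine (hU'.mul hU'.conjTranspose i j).unique
      ((hasDerivAt_const x ((1 : Matrix (Fin 2) (Fin 2) ℂ) i j)).congr_of_eventuallyEq ?_)
    filter_upwards [hU] with y hy
    exact congrFun (congrFun (Matrix.mem_unitaryGroup_iff.1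
      (Matrix.mem_specialUnitaryGroup_iff.1 hy).1) i) j
  have hdet : U' 0 0 * U x 1 1 + U x 0 0 * U' 1 1 - (U' 0 1 * U x 1 0 + U x 0 1 * U' 1 0) = 0 := by
    refine (((hU' 0 0).fun_mul (hU' 1 1)).fun_sub ((hU' 0 1).fun_mul (hU' 1 0))).unique
      ((hasDerivAt_const x (1 : ℂ)).congr_of_eventuallyEq ?_)
    filter_upwards [hU] with y hy
    rw [← Matrix.det_fin_two, (Matrix.mem_specialUnitaryGroup_iff.1 hy).2]
  obtain ⟨hU₁, hU₂⟩ := Matrix.mem_specialUnitaryGroup_iff.1 hU.self_of_nhds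
  have hadj : (U x)ᴴ = (U x).adjugate := by
    rw [← Matrix.star_eq_conjTranspose,
      ← Matrix.inv_eq_left_inv (Matrix.mem_unitaryGroup_iff'.1 hU₁), Matrix.inv_def, hU₂,
      Ring.inverse_one, one_smul]
  constructor
  · rw [Matrix.conjTranspose_mul, Matrix.conjTranspose_conjTranspose]
    exact eq_neg_of_add_eq_zero_right hunitary
  · rw [hadj, Matrix.adjugate_fin_two, Matrix.trace_fin_two]
    simp only [Matrix.mul_apply, Fin.sum_univ_two, Matrix.of_apply, Matrix.cons_val',
      Matrix.cons_val_zero, Matrix.cons_val_one, Matrix.cons_val_fin_one]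
    linear_combination hdet

end Su2

section ExtendedFrame

variable {q : ℝ → ℝ → ℂ} {h : ℝ → ℝ → ℝ} {F : ℝ → ℝ → ℝ → Matrix (Fin 2) (Fin 2) ℂ}

/-- An extended frame of the solution `q` of the Pohlmeyer-Lund-Regge equation: a smooth
`SU(2)`-valued family of solutions of the Lax pair, parametrized by the spectral parameter
`l > 0`. -/
structure IsExtendedFrame (q : ℝ → ℝ → ℂ) (h : ℝ → ℝ → ℝ)
    (F : ℝ → ℝ → ℝ → Matrix (Fin 2) (Fin 2) ℂ) : Prop where
  contDiffOn : ∀ i j, ContDiffOn ℝ ∞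
    (fun p : ℝ × ℝ × ℝ => F p.1 p.2.1 p.2.2 i j) {p | 0 < p.2.2}
  mem_specialUnitaryGroup : ∀ s t l, 0 < l → F s t l ∈ Matrix.specialUnitaryGroup (Fin 2) ℂ
  solvesLaxPair : ∀ l, 0 < l → SolvesLaxPair (fun s t => F s t l) (laxL q l) (laxM q h l)

theorem laxL_eq_add_smul (q : ℝ → ℝ → ℂ) (l s t : ℝ) :
    laxL q l s t = laxL q 0 s t + (l : ℂ) • su2OfR3 ![0, 0, 1] := by
  ext i j
  fin_cases i <;> fin_cases j <;> simp [laxL, su2OfR3] <;> ring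

theorem laxM_eq_inv_smul (q : ℝ → ℝ → ℂ) (h : ℝ → ℝ → ℝ) (l s t : ℝ) :
    laxM q h l s t = (l : ℂ)⁻¹ • laxM q h 1 s t := by
  rw [laxM, laxM, smul_smul]
  congr 1
  rw [Complex.ofReal_one, mul_one, div_eq_mul_inv, mul_inv, div_eq_mul_inv]
  ring

theorem hasEntrywiseDerivAt_laxL (q : ℝ → ℝ → ℂ) (s t : ℝ) :
    HasEntrywiseDerivAt (fun l => laxL q l s t) (su2OfR3 ![0, 0, 1]) 1 := fun i j => by
  have heq : (fun l => laxL q l s t i j) =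
      fun l : ℝ => laxL q 0 s t i j + (l : ℂ) * su2OfR3 ![0, 0, 1] i j :=
    funext fun l => congrFun (congrFun (laxL_eq_add_smul q l s t) i) j
  rw [heq]
  have hid : HasDerivAt (fun l : ℝ => (l : ℂ)) 1 1 := Complex.ofRealCLM.hasDerivAt
  exact ((hid.mul_const _).const_add _).congr_deriv (one_mul _)

theorem hasEntrywiseDerivAt_laxM (q : ℝ → ℝ → ℂ) (h : ℝ → ℝ → ℝ) (s t : ℝ) :
    HasEntrywiseDerivAt (fun l => laxM q h l s t) (-laxM q h 1 s t) 1 := fun i j => by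
  have heq : (fun l => laxM q h l s t i j) = fun l : ℝ => (l : ℂ)⁻¹ * laxM q h 1 s t i j :=
    funext fun l => congrFun (congrFun (laxM_eq_inv_smul q h l s t) i) j
  rw [heq]
  have hid : HasDerivAt (fun l : ℝ => (l : ℂ)) 1 1 := Complex.ofRealCLM.hasDerivAt
  exact ((hid.fun_inv (by simp)).mul_const _).congr_deriv (by simp)

namespace IsExtendedFrame

theorem contDiffAt (hF : IsExtendedFrame q h F) {E : Type*} [NormedAddCommGroup E]
    [NormedSpace ℝ E] {a b r : E → ℝ} {x : E} (ha : ContDiff ℝ ∞ a) (hb : ContDiff ℝ ∞ b)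
    (hr : ContDiff ℝ ∞ r) (hpos : 0 < r x) (i j : Fin 2) :
    ContDiffAt ℝ ∞ (fun y => F (a y) (b y) (r y) i j) x :=
  ((hF.contDiffOn i j).contDiffAt
    ((isOpen_lt continuous_const (by fun_prop)).mem_nhds hpos)).comp
      (f := fun y => (a y, b y, r y)) x (ha.prodMk (hb.prodMk hr)).contDiffAt

theorem symFormula_eq (hF : IsExtendedFrame q h F) (s t : ℝ) :
    symFormula F s t = entrywiseDeriv (F s t) 1 * (F s t 1)ᴴ := by
  have hunit := (Matrix.mem_specialUnitaryGroup_iff.1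
    (hF.mem_specialUnitaryGroup s t 1 one_pos)).1
  rw [symFormula, Matrix.inv_eq_left_inv (Matrix.mem_unitaryGroup_iff'.1 hunit)]
  rfl

theorem hasEntrywiseDerivAt_spectral (hF : IsExtendedFrame q h F) (s t : ℝ) :
    HasEntrywiseDerivAt (F s t) (entrywiseDeriv (F s t) 1) 1 := fun i j =>
  ((hF.contDiffAt contDiff_const contDiff_const contDiff_id one_pos i j).differentiableAt
    (by simp)).hasDerivAt

theorem isSu2_symFormula (hF : IsExtendedFrame q h F) (s t : ℝ) : IsSu2 (symFormula F s t) := by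
  rw [hF.symFormula_eq]
  exact isSu2_mul_conjTranspose
    ((lt_mem_nhds one_pos).mono fun l hl => hF.mem_specialUnitaryGroup s t l hl)
    (hF.hasEntrywiseDerivAt_spectral s t)

theorem hasEntrywiseDerivAt_symFormula_fst (hF : IsExtendedFrame q h F) (s t : ℝ) :
    HasEntrywiseDerivAt (fun x => symFormula F x t)
      (F s t 1 * su2OfR3 ![0, 0, 1] * (F s t 1)ᴴ) s := by
  simp only [hF.symFormula_eq]
  exact hasEntrywiseDerivAt_entrywiseDeriv_mul_conjTranspose (G := fun x l => F x t l)
    (fun i j => (hF.contDiffAt contDiff_fst contDiff_const contDiff_snd one_pos i j).of_le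
      (by norm_cast))
    ((lt_mem_nhds one_pos).mono fun l hl i j => (hF.solvesLaxPair l hl s t i j).1)
    (hasEntrywiseDerivAt_laxL q s t) (isSu2_laxL q 1 s t).1

theorem hasEntrywiseDerivAt_symFormula_snd (hF : IsExtendedFrame q h F) (s t : ℝ) :
    HasEntrywiseDerivAt (symFormula F s) (F s t 1 * -laxM q h 1 s t * (F s t 1)ᴴ) t := by
  rw [funext (hF.symFormula_eq s)]
  exact hasEntrywiseDerivAt_entrywiseDeriv_mul_conjTranspose
    (fun i j => (hF.contDiffAt contDiff_const contDiff_fst contDiff_snd one_pos i j).of_le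
      (by norm_cast))
    ((lt_mem_nhds one_pos).mono fun l hl i j => (hF.solvesLaxPair l hl s t i j).2)
    (hasEntrywiseDerivAt_laxM q h s t) (isSu2_laxM q h 1 s t).1

theorem contDiff_symFormula (hF : IsExtendedFrame q h F) (i j : Fin 2) :
    ContDiff ℝ ∞ fun p : ℝ × ℝ => symFormula F p.1 p.2 i j := by
  have hval (i j : Fin 2) : ContDiff ℝ ∞ fun p : ℝ × ℝ => F p.1 p.2 1 i j :=
    contDiff_iff_contDiffAt.2 fun _ =>
      hF.contDiffAt contDiff_fst contDiff_snd contDiff_const one_pos i j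
  have hderiv (i j : Fin 2) : ContDiff ℝ ∞ fun p : ℝ × ℝ => entrywiseDeriv (F p.1 p.2) 1 i j := by
    refine contDiff_iff_contDiffAt.2 fun p => ?_
    have huncurry : ContDiffAt ℝ ∞
        (Function.uncurry fun (p : ℝ × ℝ) l => F p.1 p.2 l i j) (p, 1) :=
      hF.contDiffAt contDiff_fst.fst contDiff_fst.snd contDiff_snd one_pos i j
    exact (huncurry.fderiv contDiffAt_const le_rfl).clm_apply contDiffAt_const
  simp only [hF.symFormula_eq, Matrix.mul_apply, Matrix.conjTranspose_apply]
  exact ContDiff.sum fun k _ => (hderiv i k).mul (Complex.conjCLE.contDiff.comp (hval j k))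

theorem isLundReggeEvolution (hF : IsExtendedFrame q h F) :
    IsLundReggeEvolution fun s t => r3OfSu2 (symFormula F s t) := by
  refine ⟨contDiff_r3OfSu2 hF.contDiff_symFormula, fun s t => ?_⟩
  have hU := (Matrix.mem_specialUnitaryGroup_iff.1
    (hF.mem_specialUnitaryGroup s t 1 one_pos)).1
  have hB := isSu2_su2OfR3 ![0, 0, 1]
  have hM := isSu2_laxM q h 1 s t
  have hs y : deriv (fun x => r3OfSu2 (symFormula F x y)) s = _ :=
    (hF.hasEntrywiseDerivAt_symFormula_fst s y).r3OfSu2.deriv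
  have hst := (HasEntrywiseDerivAt.mul_mul_conjTranspose (A := fun y => F s y 1)
    (fun i j => (hF.solvesLaxPair 1 one_pos s t i j).2) hM.1
      (su2OfR3 ![0, 0, 1])).r3OfSu2.deriv
  simp only [hs]
  rw [hst, (hF.hasEntrywiseDerivAt_symFormula_snd s t).r3OfSu2.deriv,
    ← (hB.mul_mul_conjTranspose hU).r3OfSu2_commutator (hM.neg.mul_mul_conjTranspose hU),
    commutator_conj hU]
  congr 3
  noncomm_ring

theorem hasUnitSpeed (hF : IsExtendedFrame q h F) :
    HasUnitSpeed fun s t => r3OfSu2 (symFormula F s t) := fun s t => by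
  have hU := (Matrix.mem_specialUnitaryGroup_iff.1
    (hF.mem_specialUnitaryGroup s t 1 one_pos)).1
  have hB := isSu2_su2OfR3 ![0, 0, 1]
  rw [(hF.hasEntrywiseDerivAt_symFormula_fst s t).r3OfSu2.deriv,
    hB.norm_r3OfSu2_mul_mul_conjTranspose hU]
  simp [r3OfSu2, su2OfR3, EuclideanSpace.norm_eq, Fin.sum_univ_three]

end IsExtendedFrame

end ExtendedFrame

/-! ### The normalized wave function -/

section Frame

variable {N : ℕ} {α c : Fin N → ℂ}

theorem norm_expFun_ofReal (s t l : ℝ) : ‖expFun s t l‖ = 1 := by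
  have h : expFun s t l * conj (expFun s t l) = 1 := by
    rw [conj_expFun, Complex.conj_ofReal, mul_inv_cancel₀ (expFun_ne_zero s t l)]
  rw [Complex.mul_conj', ← Complex.ofReal_pow, Complex.ofReal_eq_one] at h
  exact (pow_eq_one_iff_of_nonneg (norm_nonneg _) two_ne_zero).1 h

theorem norm_Psi_zero_zero (s t l : ℝ) : ‖Psi α c s t l 0 0‖ = ‖f α c s t l‖ := by
  rw [f, norm_mul, ← Complex.ofReal_neg, norm_expFun_ofReal, mul_one]

theorem norm_Psi_one_zero (s t l : ℝ) : ‖Psi α c s t l 1 0‖ = ‖g α c s t l‖ := by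
  rw [g, norm_mul, norm_expFun_ofReal, mul_one]

theorem det_Psi_ofReal (s t l : ℝ) :
    (Psi α c s t l).det = ((‖f α c s t l‖ ^ 2 + ‖g α c s t l‖ ^ 2 : ℝ) : ℂ) := by
  rw [(isQuaternionic_Psi s t).det_ofReal, norm_Psi_zero_zero, norm_Psi_one_zero]

theorem norm_sq_f_add_norm_sq_g (hα : Function.Injective (nodes α)) (s t l : ℝ) :
    ‖f α c s t l‖ ^ 2 + ‖g α c s t l‖ ^ 2 = nodeNorm α l := by
  rw [f_eq, g_eq]
  exact (isDateSolution hα s t).norm_sq_eval_ofReal hα (weightFst_ne_zero s t) l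

theorem frame_eq (hα : Function.Injective (nodes α)) (s t l : ℝ) :
    frame α c s t l = (√(nodeNorm α l) : ℂ)⁻¹ • Psi α c s t l := by
  rw [frame, det_Psi_ofReal, Complex.ofReal_re, norm_sq_f_add_norm_sq_g hα]

theorem frame_mem_specialUnitaryGroup (hα : Function.Injective (nodes α)) (s t l : ℝ) :
    frame α c s t l ∈ Matrix.specialUnitaryGroup (Fin 2) ℂ := by
  have hnorm : ‖Psi α c s t l 0 0‖ ^ 2 + ‖Psi α c s t l 1 0‖ ^ 2 = nodeNorm α l := by
    rw [norm_Psi_zero_zero, norm_Psi_one_zero, norm_sq_f_add_norm_sq_g hα]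
  rw [frame_eq hα, ← hnorm]
  exact (isQuaternionic_Psi s t).inv_sqrt_smul_mem_specialUnitaryGroup l
    (hnorm ▸ nodeNorm_pos hα l)

theorem contDiffOn_expFun :
    ContDiffOn ℝ ∞ (fun p : ℝ × ℝ × ℝ => expFun p.1 p.2.1 (p.2.2 : ℂ)) {p | 0 < p.2.2} := by
  have hofReal := Complex.ofRealCLM.contDiff (n := ∞)
  have hs := hofReal.comp (contDiff_fst (E := ℝ) (F := ℝ × ℝ))
  have ht := hofReal.comp (contDiff_snd (E := ℝ) (F := ℝ × ℝ)).fst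
  have hl := hofReal.comp (contDiff_snd (E := ℝ) (F := ℝ × ℝ)).snd
  unfold expFun
  exact (contDiffOn_const.mul ((hl.mul hs).contDiffOn.add ((hl.contDiffOn.inv fun p hp =>
    Complex.ofReal_ne_zero.2 hp.ne').mul ht.contDiffOn))).cexp

theorem contDiff_eval_ofFn {v : ℝ × ℝ → Fin N → ℂ} (hv : ∀ j, ContDiff ℝ ∞ fun p => v p j) :
    ContDiff ℝ ∞ fun p : ℝ × ℝ × ℝ => (ofFn N (v (p.1, p.2.1))).eval (p.2.2 : ℂ) := by
  simp only [eval_ofFn]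
  exact ContDiff.sum fun j _ => ((hv j).comp (contDiff_fst.prodMk contDiff_snd.fst)).mul
    ((Complex.ofRealCLM.contDiff.comp contDiff_snd.snd).pow _)

theorem contDiffOn_Psi (hα : Function.Injective (nodes α)) (i j : Fin 2) : ContDiffOn ℝ ∞
    (fun p : ℝ × ℝ × ℝ => Psi α c p.1 p.2.1 (p.2.2 : ℂ) i j) {p | 0 < p.2.2} := by
  have hfst : ContDiffOn ℝ ∞
      (fun p : ℝ × ℝ × ℝ => Psi α c p.1 p.2.1 (p.2.2 : ℂ) 0 0) {p | 0 < p.2.2} := by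
    simp only [Psi_zero_zero, fPoly, eval_add, eval_pow, eval_X]
    exact (((Complex.ofRealCLM.contDiff.comp contDiff_snd.snd).pow N).add
      (contDiff_eval_ofFn fun j => contDiff_d_div_d_zero hα (j + 1))).contDiffOn.mul
        contDiffOn_expFun
  have hsnd : ContDiffOn ℝ ∞
      (fun p : ℝ × ℝ × ℝ => Psi α c p.1 p.2.1 (p.2.2 : ℂ) 1 0) {p | 0 < p.2.2} := by
    simp only [Psi_one_zero, gPoly, eval_neg]
    exact (contDiff_eval_ofFn fun j =>
      contDiff_d_div_d_zero hα (N + j + 1)).neg.contDiffOn.mul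
        (contDiffOn_expFun.inv fun p _ => expFun_ne_zero _ _ _)
  have hΨ (p : ℝ × ℝ × ℝ) := isQuaternionic_Psi (α := α) (c := c) p.1 p.2.1 p.2.2
  simp only [Complex.conj_ofReal] at hΨ
  fin_cases i <;> fin_cases j
  · exact hfst
  · exact (Complex.conjCLE.contDiff.comp_contDiffOn hsnd).neg.congr fun p _ => (hΨ p).1
  · exact hsnd
  · exact (Complex.conjCLE.contDiff.comp_contDiffOn hfst).congr fun p _ => (hΨ p).2

theorem contDiff_inv_sqrt_nodeNorm (hα : Function.Injective (nodes α)) :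
    ContDiff ℝ ∞ fun l => (√(nodeNorm α l))⁻¹ :=
  ((contDiff_nodeNorm α).sqrt fun l => (nodeNorm_pos hα l).ne').inv fun l =>
    (Real.sqrt_pos.2 (nodeNorm_pos hα l)).ne'

theorem isExtendedFrame_frame (hN : 0 < N) (hα : Function.Injective (nodes α)) :
    IsExtendedFrame (solitonSolution α c) (solitonPotential α c) (frame α c) where
  contDiffOn i j := by
    simp only [frame_eq hα, ← Complex.ofReal_inv, Matrix.smul_apply, smul_eq_mul]
    exact (Complex.ofRealCLM.contDiff.comp
      ((contDiff_inv_sqrt_nodeNorm hα).comp contDiff_snd.snd)).contDiffOn.mul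
        (contDiffOn_Psi hα i j)
  mem_specialUnitaryGroup s t l _ := frame_mem_specialUnitaryGroup hα s t l
  solvesLaxPair l hl s t i j := by
    obtain ⟨hs, ht⟩ := Psi_solvesLaxPair (c := c) hN hα (Complex.ofReal_ne_zero.2 hl.ne') s t i j
    rw [← dateL_eq_laxL, ← dateM_eq_laxM hN hα]
    simp only [frame_eq hα, Matrix.smul_mul, Matrix.smul_apply, smul_eq_mul]
    exact ⟨hs.const_mul _, ht.const_mul _⟩

/-! ### The explicit formula for the curve -/

theorem hasDerivAt_expFun_ofReal (s t : ℝ) :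
    HasDerivAt (fun l : ℝ => expFun s t (l : ℂ))
      (Complex.I / 2 * ((s : ℂ) - t) * expFun s t (1 : ℝ)) 1 := by
  have hl : HasDerivAt (fun l : ℝ => (l : ℂ)) 1 1 := Complex.ofRealCLM.hasDerivAt
  unfold expFun
  refine ((((hl.mul_const (s : ℂ)).fun_add ((hl.fun_inv (by simp)).mul_const (t : ℂ))).const_mul
    (Complex.I / 2)).cexp).congr_deriv ?_
  simp only [Complex.ofReal_one, one_mul, inv_one, one_pow, div_one, neg_mul]
  ring

/-- The diagonal factor `diag(e, e⁻¹)` of the wave function. -/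
noncomputable def phaseMatrix (s t : ℝ) (l : ℂ) : Matrix (Fin 2) (Fin 2) ℂ :=
  Matrix.diagonal ![expFun s t l, (expFun s t l)⁻¹]

theorem phaseMatrix_mul_conjTranspose (s t l : ℝ) :
    phaseMatrix s t l * (phaseMatrix s t l)ᴴ = 1 := by
  have he := expFun_ne_zero s t l
  ext i j
  fin_cases i <;> fin_cases j <;>
    simp [phaseMatrix, Matrix.diagonal_conjTranspose, conj_expFun, he]

theorem hasEntrywiseDerivAt_phaseMatrix (s t : ℝ) :
    HasEntrywiseDerivAt (fun l : ℝ => phaseMatrix s t l)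
      ((Complex.I / 2 * ((s : ℂ) - t)) • Matrix.diagonal ![1, -1] * phaseMatrix s t (1 : ℝ))
      1 := fun i j => by
  have he := hasDerivAt_expFun_ofReal s t
  have he₀ := expFun_ne_zero s t (1 : ℝ)
  fin_cases i <;> fin_cases j <;> simp only [phaseMatrix]
  · exact he.congr_deriv (by simp)
  · exact (hasDerivAt_const _ _).congr_deriv (by simp)
  · exact (hasDerivAt_const _ _).congr_deriv (by simp)
  · refine (he.fun_inv he₀).congr_deriv ?_
    simp only [Fin.mk_one, Matrix.mul_diagonal, Matrix.smul_apply, Matrix.diagonal_apply_eq,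
      Matrix.cons_val_one, Matrix.cons_val_fin_one, smul_eq_mul, mul_neg, mul_one]
    field_simp

variable (α c) in
/-- The factor `!![f, -ḡ; g, f̄]` of the wave function at a real spectral parameter. -/
noncomputable def amplitudeMatrix (s t l : ℝ) : Matrix (Fin 2) (Fin 2) ℂ :=
  !![f α c s t l, -conj (g α c s t l); g α c s t l, conj (f α c s t l)]

theorem Psi_ofReal (s t l : ℝ) :
    Psi α c s t l = phaseMatrix s t l * amplitudeMatrix α c s t l := by
  obtain ⟨h₀, h₁⟩ := isQuaternionic_Psi (α := α) (c := c) s t l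
  ext i j
  fin_cases i <;> fin_cases j <;>
    simp [phaseMatrix, amplitudeMatrix, h₀, h₁, Psi_zero_zero, Psi_one_zero, f_eq, g_eq,
      conj_expFun, mul_comm]

theorem f_mul_conj_add_g_mul_conj (hα : Function.Injective (nodes α)) (s t l : ℝ) :
    f α c s t l * conj (f α c s t l) + g α c s t l * conj (g α c s t l) =
      (nodeNorm α l : ℂ) := by
  rw [← norm_sq_f_add_norm_sq_g (c := c) hα s t l, Complex.mul_conj', Complex.mul_conj']
  push_cast
  rfl

theorem amplitudeMatrix_mul_conjTranspose (hα : Function.Injective (nodes α)) (s t l : ℝ) :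
    amplitudeMatrix α c s t l * (amplitudeMatrix α c s t l)ᴴ = (nodeNorm α l : ℂ) • 1 := by
  rw [← f_mul_conj_add_g_mul_conj (c := c) hα s t l]
  ext i j
  fin_cases i <;> fin_cases j <;> simp [amplitudeMatrix, Matrix.mul_apply] <;> ring

theorem differentiableAt_f (s t l : ℝ) : DifferentiableAt ℝ (fun l : ℝ => f α c s t l) l := by
  simp only [f_eq]
  exact ((fPoly α c s t).hasDerivAt l).comp_ofReal.differentiableAt

theorem differentiableAt_g (s t l : ℝ) : DifferentiableAt ℝ (fun l : ℝ => g α c s t l) l := by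
  simp only [g_eq]
  exact ((gPoly α c s t).hasDerivAt l).comp_ofReal.differentiableAt

theorem hasEntrywiseDerivAt_amplitudeMatrix (s t l : ℝ) :
    HasEntrywiseDerivAt (amplitudeMatrix α c s t)
      (entrywiseDeriv (amplitudeMatrix α c s t) l) l := fun i j => by
  have hf := differentiableAt_f (α := α) (c := c) s t l
  have hg := differentiableAt_g (α := α) (c := c) s t l
  refine DifferentiableAt.hasDerivAt ?_
  fin_cases i <;> fin_cases j
  exacts [hf, hg.star.neg, hg, hf.star]

theorem deriv_smul_mul_mul_conjTranspose {n : Type*} [Fintype n] [DecidableEq n]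
    {D K Q Q' : Matrix n n ℂ} {r r' S : ℝ} (hD : D * Dᴴ = 1) (hQ : Q * Qᴴ = (S : ℂ) • 1)
    (hr : r * r * S = 1) :
    ((r' : ℂ) • (D * Q) + (r : ℂ) • (K * D * Q + D * Q')) * ((r : ℂ) • (D * Q))ᴴ =
      ((r' * r * S : ℝ) : ℂ) • 1 + K + ((r * r : ℝ) : ℂ) • (D * (Q' * Qᴴ) * Dᴴ) := by
  have hDQ : D * Q * (D * Q)ᴴ = (S : ℂ) • 1 := by
    rw [Matrix.conjTranspose_mul, Matrix.mul_assoc, ← Matrix.mul_assoc Q, hQ, Matrix.smul_mul,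
      Matrix.one_mul, Matrix.mul_smul, hD]
  calc _ = ((r' : ℂ) * r) • (D * Q * (D * Q)ᴴ) + ((r : ℂ) * r) • (K * (D * Q * (D * Q)ᴴ)) +
        ((r : ℂ) * r) • (D * (Q' * Qᴴ) * Dᴴ) := by
        simp only [Matrix.conjTranspose_smul, Complex.star_def, Complex.conj_ofReal,
          Matrix.add_mul, Matrix.smul_mul, Matrix.mul_smul, smul_smul, smul_add,
          Matrix.conjTranspose_mul, Matrix.mul_assoc, mul_comm (r : ℂ) (r' : ℂ), add_assoc]
    _ = _ := by
        rw [hDQ, Matrix.mul_smul, Matrix.mul_one, smul_smul, smul_smul, ← Complex.ofReal_mul,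
          ← Complex.ofReal_mul, ← Complex.ofReal_mul, ← Complex.ofReal_mul, hr,
          Complex.ofReal_one, one_smul]

theorem exists_symFormula_frame (hN : 0 < N) (hα : Function.Injective (nodes α)) (s t : ℝ) :
    ∃ r : ℝ, symFormula (frame α c) s t =
      (r : ℂ) • 1 + (Complex.I / 2 * ((s : ℂ) - t)) • Matrix.diagonal ![1, -1] +
        (nodeNorm α 1 : ℂ)⁻¹ • (phaseMatrix s t (1 : ℝ) *
          (entrywiseDeriv (amplitudeMatrix α c s t) 1 * (amplitudeMatrix α c s t 1)ᴴ) *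
            (phaseMatrix s t (1 : ℝ))ᴴ) := by
  set R : ℝ → ℝ := fun l => (√(nodeNorm α l))⁻¹ with hR
  have hsq : R 1 * R 1 = (nodeNorm α 1)⁻¹ := by
    rw [hR, ← mul_inv, Real.mul_self_sqrt (nodeNorm_pos hα 1).le]
  have hR' : HasDerivAt (fun l => (R l : ℂ)) (deriv R 1 : ℝ) 1 :=
    ((contDiff_inv_sqrt_nodeNorm hα).differentiable (by simp) 1).hasDerivAt.ofReal_comp
  have hframe : frame α c s t =
      fun l => (R l : ℂ) • (phaseMatrix s t l * amplitudeMatrix α c s t l) := by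
    ext1 l
    rw [frame_eq hα, Psi_ofReal, hR, Complex.ofReal_inv]
  have hderiv := ((hasEntrywiseDerivAt_phaseMatrix s t).mul
    (hasEntrywiseDerivAt_amplitudeMatrix (α := α) (c := c) s t 1)).smul hR'
  rw [(isExtendedFrame_frame hN hα).symFormula_eq, hframe, hderiv.entrywiseDeriv_eq,
    deriv_smul_mul_mul_conjTranspose (phaseMatrix_mul_conjTranspose s t 1)
      (amplitudeMatrix_mul_conjTranspose hα s t 1)
      (by rw [hsq, inv_mul_cancel₀ (nodeNorm_pos hα 1).ne']), hsq, Complex.ofReal_inv]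
  exact ⟨_, rfl⟩

theorem phaseMatrix_mul_mul_conjTranspose_one_zero (s t l : ℝ) (A : Matrix (Fin 2) (Fin 2) ℂ) :
    (phaseMatrix s t l * A * (phaseMatrix s t l)ᴴ) 1 0 = A 1 0 * conj (expFun s t l) ^ 2 := by
  rw [phaseMatrix, Matrix.diagonal_conjTranspose, Matrix.mul_diagonal, Matrix.diagonal_mul,
    conj_expFun, Complex.conj_ofReal]
  simp only [Pi.star_apply, Matrix.cons_val_zero, Matrix.cons_val_one, Matrix.cons_val_fin_one,
    Complex.star_def, conj_expFun, Complex.conj_ofReal]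
  ring

theorem phaseMatrix_mul_mul_conjTranspose_zero_zero (s t l : ℝ) (A : Matrix (Fin 2) (Fin 2) ℂ) :
    (phaseMatrix s t l * A * (phaseMatrix s t l)ᴴ) 0 0 = A 0 0 := by
  have he := expFun_ne_zero s t l
  rw [phaseMatrix, Matrix.diagonal_conjTranspose, Matrix.mul_diagonal, Matrix.diagonal_mul]
  simp only [Pi.star_apply, Matrix.cons_val_zero, Complex.star_def, conj_expFun,
    Complex.conj_ofReal]
  field_simp

theorem entrywiseDeriv_amplitudeMatrix_mul_conjTranspose_one_zero (s t l : ℝ) :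
    (entrywiseDeriv (amplitudeMatrix α c s t) l * (amplitudeMatrix α c s t l)ᴴ) 1 0 =
      conj (f α c s t l) * deriv (fun l : ℝ => g α c s t l) l
        - g α c s t l * deriv (fun l : ℝ => conj (f α c s t l)) l := by
  simp only [entrywiseDeriv, amplitudeMatrix, Matrix.mul_apply, Fin.sum_univ_two,
    Matrix.conjTranspose_apply, Matrix.of_apply, Matrix.cons_val', Matrix.cons_val_zero,
    Matrix.cons_val_one, Matrix.cons_val_fin_one, Complex.star_def, map_neg, Complex.conj_conj]
  ring

theorem entrywiseDeriv_amplitudeMatrix_mul_conjTranspose_zero_zero (s t l : ℝ) :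
    (entrywiseDeriv (amplitudeMatrix α c s t) l * (amplitudeMatrix α c s t l)ᴴ) 0 0 =
      conj (f α c s t l) * deriv (fun l : ℝ => f α c s t l) l
        + g α c s t l * deriv (fun l : ℝ => conj (g α c s t l)) l := by
  simp only [entrywiseDeriv, amplitudeMatrix, Matrix.mul_apply, Fin.sum_univ_two,
    Matrix.conjTranspose_apply, Matrix.of_apply, Matrix.cons_val', Matrix.cons_val_zero,
    Matrix.cons_val_one, Matrix.cons_val_fin_one, Complex.star_def, map_neg, Complex.conj_conj,
    deriv.fun_neg]
  ring

theorem symFormula_frame_one_zero (hN : 0 < N) (hα : Function.Injective (nodes α)) (s t : ℝ) :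
    symFormula (frame α c) s t 1 0 =
      (conj (f α c s t 1) * deriv (fun l : ℝ => g α c s t l) 1
          - g α c s t 1 * deriv (fun l : ℝ => conj (f α c s t l)) 1)
        / (f α c s t 1 * conj (f α c s t 1) + g α c s t 1 * conj (g α c s t 1))
        * conj (expFun s t 1) ^ 2 := by
  obtain ⟨r, hr⟩ := exists_symFormula_frame (c := c) hN hα s t
  have hnorm := f_mul_conj_add_g_mul_conj (c := c) hα s t 1
  rw [Complex.ofReal_one] at hnorm
  rw [hr, hnorm, Matrix.add_apply, Matrix.add_apply, Matrix.smul_apply, Matrix.smul_apply,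
    Matrix.smul_apply, phaseMatrix_mul_mul_conjTranspose_one_zero,
    entrywiseDeriv_amplitudeMatrix_mul_conjTranspose_one_zero, Matrix.one_apply_ne one_ne_zero,
    Matrix.diagonal_apply_ne _ one_ne_zero, smul_zero, smul_zero, zero_add, zero_add,
    smul_eq_mul, Complex.ofReal_one]
  ring

theorem exists_symFormula_frame_zero_zero (hN : 0 < N) (hα : Function.Injective (nodes α))
    (s t : ℝ) : ∃ r : ℝ, symFormula (frame α c) s t 0 0 = r + Complex.I / 2 * ((s : ℂ) - t) +
      (conj (f α c s t 1) * deriv (fun l : ℝ => f α c s t l) 1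
          + g α c s t 1 * deriv (fun l : ℝ => conj (g α c s t l)) 1)
        / (f α c s t 1 * conj (f α c s t 1) + g α c s t 1 * conj (g α c s t 1)) := by
  obtain ⟨r, hr⟩ := exists_symFormula_frame (c := c) hN hα s t
  have hnorm := f_mul_conj_add_g_mul_conj (c := c) hα s t 1
  rw [Complex.ofReal_one] at hnorm
  refine ⟨r, ?_⟩
  rw [hr, hnorm, Matrix.add_apply, Matrix.add_apply, Matrix.smul_apply, Matrix.smul_apply,
    Matrix.smul_apply, phaseMatrix_mul_mul_conjTranspose_zero_zero,
    entrywiseDeriv_amplitudeMatrix_mul_conjTranspose_zero_zero, Matrix.one_apply_eq,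
    Matrix.diagonal_apply_eq, Matrix.cons_val_zero, smul_eq_mul, smul_eq_mul, smul_eq_mul,
    mul_one, mul_one, Complex.ofReal_one]
  ring

theorem solitonCurve_apply_two (hN : 0 < N) (hα : Function.Injective (nodes α)) (s t : ℝ) :
    solitonCurve α c s t 2 =
      s - t + 2 * ((conj (f α c s t 1) * deriv (fun l : ℝ => f α c s t l) 1
          + g α c s t 1 * deriv (fun l : ℝ => conj (g α c s t l)) 1)
        / (f α c s t 1 * conj (f α c s t 1) + g α c s t 1 * conj (g α c s t 1))).im := by
  obtain ⟨r, hr⟩ := exists_symFormula_frame_zero_zero (c := c) hN hα s t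
  have hphase : (Complex.I / 2 * ((s : ℂ) - t)).im = (s - t) / 2 := by
    rw [div_mul_eq_mul_div, ← Complex.ofReal_sub, Complex.div_ofNat_im, Complex.I_mul_im,
      Complex.ofReal_re]
  change 2 * (symFormula (frame α c) s t 0 0).im = _
  rw [hr, Complex.add_im, Complex.add_im, Complex.ofReal_im, hphase]
  ring

end Frame

end LundRegge

open LundRegge in
theorem proposition3p11_general (N : ℕ) (hN : 0 < N) (α c : Fin N → ℂ)
    (hα : Function.Injective α)
    (hconj : ∀ j k, α j ≠ conj (α k)) :
    (∀ s t : ℝ, d α c 0 s t ≠ 0) ∧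
    (∀ (s t : ℝ) (j : Fin N), Matrix.vecMul ![1, c j] (Psi α c s t (α j)) = 0) ∧
    (∀ l : ℂ, l ≠ 0 → SolvesLaxPair (fun s t => Psi α c s t l)
      (fun s t => dateL α c s t l) (fun s t => dateM α c s t l)) ∧
    (∀ (s t : ℝ) (l : ℂ), l ≠ 0 →
      f α c s t l = l ^ N +
        ∑ j : Fin N, d α c ((j : ℕ) + 1) s t / d α c 0 s t * l ^ (j : ℕ) ∧
      g α c s t l =
        -∑ j : Fin N, d α c (N + (j : ℕ) + 1) s t / d α c 0 s t * l ^ (j : ℕ)) ∧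
    (∀ s t l : ℝ, 0 < l →
      (Psi α c s t (l : ℂ)).det = ((‖f α c s t l‖ ^ 2 + ‖g α c s t l‖ ^ 2 : ℝ) : ℂ) ∧
      0 < ‖f α c s t l‖ ^ 2 + ‖g α c s t l‖ ^ 2 ∧
      frame α c s t l ∈ Matrix.specialUnitaryGroup (Fin 2) ℂ) ∧
    (∀ i j : Fin 2, ContDiffOn ℝ ∞
      (fun p : ℝ × ℝ × ℝ => frame α c p.1 p.2.1 p.2.2 i j) {p | 0 < p.2.2}) ∧
    (∃ h : ℝ → ℝ → ℝ, IsPLRSolution (solitonSolution α c) h ∧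
      ∀ l : ℝ, 0 < l → SolvesLaxPair (fun s t => frame α c s t l)
        (laxL (solitonSolution α c) l) (laxM (solitonSolution α c) h l)) ∧
    (∀ s t : ℝ, su2OfR3 (solitonCurve α c s t) = symFormula (frame α c) s t) ∧
    IsLundReggeEvolution (solitonCurve α c) ∧
    HasUnitSpeed (solitonCurve α c) ∧
    (∀ s t : ℝ,
      solitonCurve α c s t 0 =
        2 * ((conj (f α c s t 1) * deriv (fun l : ℝ => g α c s t l) 1
              - g α c s t 1 * deriv (fun l : ℝ => conj (f α c s t l)) 1)
            / (f α c s t 1 * conj (f α c s t 1) + g α c s t 1 * conj (g α c s t 1))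
            * conj (expFun s t 1) ^ 2).re ∧
      solitonCurve α c s t 1 =
        -2 * ((conj (f α c s t 1) * deriv (fun l : ℝ => g α c s t l) 1
              - g α c s t 1 * deriv (fun l : ℝ => conj (f α c s t l)) 1)
            / (f α c s t 1 * conj (f α c s t 1) + g α c s t 1 * conj (g α c s t 1))
            * conj (expFun s t 1) ^ 2).im ∧
      solitonCurve α c s t 2 =
        s - t + 2 * ((conj (f α c s t 1) * deriv (fun l : ℝ => f α c s t l) 1
              + g α c s t 1 * deriv (fun l : ℝ => conj (g α c s t l)) 1)
            / (f α c s t 1 * conj (f α c s t 1) + g α c s t 1 * conj (g α c s t 1))).im) := by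
  have hn := nodes_injective hα hconj
  have hF := isExtendedFrame_frame (c := c) hN hn
  refine ⟨d_zero_ne_zero hn, vecMul_Psi hn, fun l hl => Psi_solvesLaxPair hN hn hl,
    fun s t l _ => ⟨(f_eq s t l).trans (eval_fPoly s t l), (g_eq s t l).trans (eval_gPoly s t l)⟩,
    fun s t l hl => ⟨det_Psi_ofReal s t l, ?_, hF.mem_specialUnitaryGroup s t l hl⟩,
    hF.contDiffOn, ⟨_, isPLRSolution hN hn, hF.solvesLaxPair⟩,
    fun s t => (hF.isSu2_symFormula s t).su2OfR3_r3OfSu2, hF.isLundReggeEvolution,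
    hF.hasUnitSpeed, fun s t => ⟨?_, ?_, solitonCurve_apply_two hN hn s t⟩⟩
  · exact (norm_sq_f_add_norm_sq_g hn s t l).symm ▸ nodeNorm_pos hn l
  · rw [← symFormula_frame_one_zero hN hn]
    rfl
  · rw [← symFormula_frame_one_zero hN hn]
    rfl

open LundRegge in
theorem proposition3p11 (N : ℕ) (hN : 0 < N) (α c : Fin N → ℂ)
    (hα : Function.Injective α)
    (him : (∀ j, 0 < (α j).im) ∨ (∀ j, (α j).im < 0)) :
    -- the linear system of the construction is non-singular, and `Ψ` is Date's wave function
    (∀ s t : ℝ, d α c 0 s t ≠ 0) ∧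
    (∀ (s t : ℝ) (j : Fin N), Matrix.vecMul ![1, c j] (Psi α c s t (α j)) = 0) ∧
    (∀ l : ℂ, l ≠ 0 → SolvesLaxPair (fun s t => Psi α c s t l)
      (fun s t => dateL α c s t l) (fun s t => dateM α c s t l)) ∧
    -- the expansions of `f` and `g`
    (∀ (s t : ℝ) (l : ℂ), l ≠ 0 →
      f α c s t l = l ^ N +
        ∑ j : Fin N, d α c ((j : ℕ) + 1) s t / d α c 0 s t * l ^ (j : ℕ) ∧
      g α c s t l =
        -∑ j : Fin N, d α c (N + (j : ℕ) + 1) s t / d α c 0 s t * l ^ (j : ℕ)) ∧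
    -- the normalized wave function is a smooth `SU(2)`-valued family for `λ > 0` that solves the
    -- Lax pair of the solution `q` of the Pohlmeyer-Lund-Regge equation
    (∀ s t l : ℝ, 0 < l →
      (Psi α c s t (l : ℂ)).det = ((‖f α c s t l‖ ^ 2 + ‖g α c s t l‖ ^ 2 : ℝ) : ℂ) ∧
      0 < ‖f α c s t l‖ ^ 2 + ‖g α c s t l‖ ^ 2 ∧
      frame α c s t l ∈ Matrix.specialUnitaryGroup (Fin 2) ℂ) ∧
    (∀ i j : Fin 2, ContDiffOn ℝ ∞
      (fun p : ℝ × ℝ × ℝ => frame α c p.1 p.2.1 p.2.2 i j) {p | 0 < p.2.2}) ∧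
    (∃ h : ℝ → ℝ → ℝ, IsPLRSolution (solitonSolution α c) h ∧
      ∀ l : ℝ, 0 < l → SolvesLaxPair (fun s t => frame α c s t l)
        (laxL (solitonSolution α c) l) (laxM (solitonSolution α c) h l)) ∧
    -- the `N`-soliton curve is the Sym formula under `ℝ³ ≅ 𝔰𝔲(2)`, and it is a unit-speed
    -- Lund-Regge evolution
    (∀ s t : ℝ, su2OfR3 (solitonCurve α c s t) = symFormula (frame α c) s t) ∧
    IsLundReggeEvolution (solitonCurve α c) ∧
    HasUnitSpeed (solitonCurve α c) ∧
    -- the explicit formula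
    (∀ s t : ℝ,
      solitonCurve α c s t 0 =
        2 * ((conj (f α c s t 1) * deriv (fun l : ℝ => g α c s t l) 1
              - g α c s t 1 * deriv (fun l : ℝ => conj (f α c s t l)) 1)
            / (f α c s t 1 * conj (f α c s t 1) + g α c s t 1 * conj (g α c s t 1))
            * conj (expFun s t 1) ^ 2).re ∧
      solitonCurve α c s t 1 =
        -2 * ((conj (f α c s t 1) * deriv (fun l : ℝ => g α c s t l) 1
              - g α c s t 1 * deriv (fun l : ℝ => conj (f α c s t l)) 1)
            / (f α c s t 1 * conj (f α c s t 1) + g α c s t 1 * conj (g α c s t 1))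
            * conj (expFun s t 1) ^ 2).im ∧
      solitonCurve α c s t 2 =
        s - t + 2 * ((conj (f α c s t 1) * deriv (fun l : ℝ => f α c s t l) 1
              + g α c s t 1 * deriv (fun l : ℝ => conj (g α c s t l)) 1)
            / (f α c s t 1 * conj (f α c s t 1) + g α c s t 1 * conj (g α c s t 1))).im) := by
  refine proposition3p11_general N hN α c hα fun j k h => ?_
  have him_eq := congrArg Complex.im h
  rw [Complex.conj_im] at him_eq
  rcases him with him | him <;> linarith [him j, him k]
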